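/- Let $L,C,R$ be finite-dimensional nonzero quantum systems; for a system $S$ let $\mathcal M_S$ be the algebra of all operators on $\mathcal H_S$, and let $\mathrm{Ad}_U(X)=UXU^\dagger$. A unitary $U$ on $LCR$ is a \emph{left-wall} if $\mathrm{Ad}_U^t(\mathcal M_L\otimes\mathbb 1_{CR})\subseteq\mathcal M_{LC}\otimes\mathbb 1_R$ for all integers $t\ge 0$. Let $\overline{\mathcal M_L}$ be the algebra generated by $\bigcup_{t\ge0}\mathrm{Ad}_U^t(\mathcal M_L\otimes\mathbb 1_{CR})$. A \emph{block decomposition} of a unital $*$-subalgebra $\mathcal A\subseteq\mathcal M_C$ is a unitary identification $\mathcal H_C\cong\bigoplus_{i=1}^n \mathcal D_i\otimes\mathcal E_i$, with $\mathcal D_i,\mathcal E_i\neq0$ and each with a fixed orthonormal basis, under which $\mathcal A$ becomes $\bigoplus_i\mathcal M_{\mathcal D_i}\otimes\mathbb 1_{\mathcal E_i}$. Blocks $i,j$ are \emph{equivalent} if $\dim\mathcal D_i=\dim\mathcal D_j$ and $\dim\mathcal E_i=\dim\mathcal E_j$; equivalent blocks are identified through the fixed bases, and for a permutation $\sigma$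 of $\{1,\dots,n\}$ with $\sigma(i)$ equivalent to $i$ for all $i$ (an \emph{admissible} permutation), $P_\sigma$ is the unitary on $C$ that carries block $i$ identically onto block $\sigma(i)$. \textbf{Theorem (wall structure).} (1) Let $U$ be a left-wall. There is exactly one unital $*$-subalgebra $\mathcal A_C\subseteq\mathcal M_C$ with $\overline{\mathcal M_L}=\mathcal M_L\otimes\mathcal A_C\otimes\mathbb 1_R$, and $\mathcal A_C$ has a block decomposition. For every block decomposition of $\mathcal A_C$ there are an admissible permutation $\sigma$ and unitaries $T^i$ on $L\mathcal D_i$ and $R^i$ on $\mathcal E_iR$ with $$U=P_\sigma\,\bigoplus_i T^i_{L\mathcal D_i}\otimes R^i_{\mathcal E_iR}.$$ (2) The unitaries and the permutation are arbitrary: for every unital $*$-subalgebra $\mathcal A_C\subseteq\mathcal M_C$ with a block decomposition, every admissible $\sigma$ and all unitaries $T^i$ on $L\mathcal D_i$ and $R^i$ on $\mathcal E_iR$, the operator $U=P_\sigma\bigoplus_iT^i\otimes R^i$ is a unitary left-wall and $\mathrm{Ad}_U(\mathcal M_L\otimes\mathcal A_C\otimes\mathbb 1_R)=\mathcal M_L\otimes\mathcal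 A_C\otimes\mathbb 1_R$. (3) (Brickwork walls.) Let $V$ on $LC$ and $W$ on $CR$ be unitaries such that $U=V_{LC}W_{CR}$ is a left-wall with $\overline{\mathcal M_L}=\mathcal M_L\otimes\mathcal A_C\otimes\mathbb 1_R$. For every block decomposition of $\mathcal A_C$ there are an admissible permutation $\sigma$ and unitaries $T^i,R^i$ with $U=P_\sigma\bigoplus_iT^i_{L\mathcal D_i}\otimes R^i_{\mathcal E_iR}$ such that for all admissible permutations $\Pi,\pi$ with $\Pi\circ\pi=\sigma$ and all unitaries $t^i$ on $\mathcal D_i$ and $r^i$ on $\mathcal E_i$ there are a unitary $G$ on $C$ and unitaries $\tilde T^i$ on $L\mathcal D_i$, $\tilde R^i$ on $\mathcal E_iR$ with $$VG^{-1}=P_\Pi\Big(P_\pi\bigoplus_i\tilde T^i_{L\mathcal D_i}\otimes r^i_{\mathcal E_i}\,P_\pi^{-1}\Big),\qquad GW=P_\pi\bigoplus_i t^i_{\mathcal D_i}\otimes\tilde R^i_{\mathcal E_iR},\qquad T^i=\tilde T^it^i,\qquad R^i=r^i\tilde R^i .$$ (4) Conversely, for every unital $*$-subalgebra $\mathcal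 A_C\subseteq\mathcal M_C$ with a block decomposition, all admissible $\Pi,\pi$ and all unitaries $\tilde T^i$ on $L\mathcal D_i$, $r^i$ on $\mathcal E_i$, $t^i$ on $\mathcal D_i$, $\tilde R^i$ on $\mathcal E_iR$, the operators $$P_\Pi\Big(P_\pi\bigoplus_i\tilde T^i\otimes r^i\,P_\pi^{-1}\Big),\qquad P_\pi\bigoplus_it^i\otimes\tilde R^i$$ are unitaries $V$ on $LC$ and $W$ on $CR$, and $U=V_{LC}W_{CR}$ is a left-wall with $\mathrm{Ad}_U(\mathcal M_L\otimes\mathcal A_C\otimes\mathbb 1_R)=\mathcal M_L\otimes\mathcal A_C\otimes\mathbb 1_R$. -/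

import Mathlib

open scoped Kronecker Matrix

namespace WallUnitary

/-! Finite-dimensional systems are given by finite index types: `L` indexes an orthonormal basis of
the Hilbert space of the left system, `Matrix L L ℂ` is its full matrix algebra, and
`L × C × R` indexes the product basis of the tripartite system. -/

section Systems

variable {L C R : Type*} [Fintype L] [DecidableEq L] [Fintype C] [DecidableEq C]
  [Fintype R] [DecidableEq R]

/-- The adjoint action `X ↦ U X U†`. -/
def Ad {S : Type*} [Fintype S] (U X : Matrix S S ℂ) : Matrix S S ℂ := U * X * Uᴴ

/-- `m ↦ m_L ⊗ 1_{CR}`. -/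
def onL (m : Matrix L L ℂ) : Matrix (L × C × R) (L × C × R) ℂ :=
  m ⊗ₖ (1 : Matrix (C × R) (C × R) ℂ)

/-- `m ↦ m_{LC} ⊗ 1_R`. -/
def onLC (m : Matrix (L × C) (L × C) ℂ) : Matrix (L × C × R) (L × C × R) ℂ :=
  Matrix.reindex (Equiv.prodAssoc L C R) (Equiv.prodAssoc L C R) (m ⊗ₖ (1 : Matrix R R ℂ))

/-- `m ↦ 1_L ⊗ m_{CR}`. -/
def onCR (m : Matrix (C × R) (C × R) ℂ) : Matrix (L × C × R) (L × C × R) ℂ :=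
  (1 : Matrix L L ℂ) ⊗ₖ m

/-- `1_L ⊗ g ⊗ 1_R` for an operator `g` between two (possibly different) central systems. -/
def onMid (L R : Type*) [DecidableEq L] [DecidableEq R] {C₁ C₂ : Type*}
    (g : Matrix C₁ C₂ ℂ) : Matrix (L × C₁ × R) (L × C₂ × R) ℂ :=
  (1 : Matrix L L ℂ) ⊗ₖ (g ⊗ₖ (1 : Matrix R R ℂ))

/-- `U` is a left-wall: at all times `t`, `Ad_U^t` maps operators on `L` to operators on `LC`. -/
def IsLeftWall (U : Matrix (L × C × R) (L × C × R) ℂ) : Prop :=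
  ∀ (t : ℕ) (m : Matrix L L ℂ), ∃ m' : Matrix (L × C) (L × C) ℂ, (Ad U)^[t] (onL m) = onLC m'

/-- The algebra generated by the operators `Ad_U^t (m_L ⊗ 1_{CR})`, `t ≥ 0`. -/
def leftClosure (U : Matrix (L × C × R) (L × C × R) ℂ) :
    Subalgebra ℂ (Matrix (L × C × R) (L × C × R) ℂ) :=
  Algebra.adjoin ℂ {X | ∃ (t : ℕ) (m : Matrix L L ℂ), X = (Ad U)^[t] (onL m)}

/-- The operator space `M_L ⊗ A ⊗ 1_R`. -/
def leftProduct (L R : Type*) [Fintype L] [DecidableEq L] [Fintype R] [DecidableEq R]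
    (A : StarSubalgebra ℂ (Matrix C C ℂ)) :
    Submodule ℂ (Matrix (L × C × R) (L × C × R) ℂ) :=
  Submodule.span ℂ {X | ∃ (m : Matrix L L ℂ) (a : Matrix C C ℂ), a ∈ A ∧
    X = m ⊗ₖ (a ⊗ₖ (1 : Matrix R R ℂ))}

/-- The algebra generated by the evolved left operators is `M_L ⊗ A ⊗ 1_R`. -/
def HasInvariantAlgebra (U : Matrix (L × C × R) (L × C × R) ℂ)
    (A : StarSubalgebra ℂ (Matrix C C ℂ)) : Prop :=
  Subalgebra.toSubmodule (leftClosure U) = leftProduct L R A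

/-- The basis of `⊕ᵢ Dᵢ ⊗ Eᵢ`, where `dim Dᵢ = d i` and `dim Eᵢ = e i`. -/
abbrev BlockIndex {n : ℕ} (d e : Fin n → ℕ) : Type := Σ i : Fin n, Fin (d i) × Fin (e i)

/-- A decomposition `H_C = ⊕ᵢ Dᵢ ⊗ Eᵢ` into nonzero blocks, given by a unitary
`Z : H_C → ⊕ᵢ Dᵢ ⊗ Eᵢ`, under which `A` becomes `⊕ᵢ M_{Dᵢ} ⊗ 1_{Eᵢ}`. -/
structure BlockDecomposition (A : StarSubalgebra ℂ (Matrix C C ℂ)) where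
  n : ℕ
  d : Fin n → ℕ
  e : Fin n → ℕ
  d_pos : ∀ i, 0 < d i
  e_pos : ∀ i, 0 < e i
  Z : Matrix (BlockIndex d e) C ℂ
  Z_mul_star : Z * Zᴴ = 1
  star_mul_Z : Zᴴ * Z = 1
  mem_iff : ∀ a : Matrix C C ℂ, a ∈ A ↔ ∃ x : (i : Fin n) → Matrix (Fin (d i)) (Fin (d i)) ℂ,
    Z * a * Zᴴ = Matrix.blockDiagonal' fun i => x i ⊗ₖ (1 : Matrix (Fin (e i)) (Fin (e i)) ℂ)

/-- `⊕ᵢ (L ⊗ Dᵢ) ⊗ (Eᵢ ⊗ R) ≅ L ⊗ (⊕ᵢ Dᵢ ⊗ Eᵢ) ⊗ R` on basis labels. -/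
def blockEquiv (L R : Type*) {n : ℕ} (d e : Fin n → ℕ) :
    (Σ i : Fin n, (L × Fin (d i)) × (Fin (e i) × R)) ≃ L × BlockIndex d e × R where
  toFun x := (x.2.1.1, ⟨x.1, x.2.1.2, x.2.2.1⟩, x.2.2.2)
  invFun y := ⟨y.2.1.1, (y.1, y.2.1.2.1), (y.2.1.2.2, y.2.2)⟩
  left_inv _ := rfl
  right_inv _ := rfl

/-- The block sum `⊕ᵢ Tⁱ_{L Dᵢ} ⊗ Rⁱ_{Eᵢ R}`. -/
def blockSum {n : ℕ} {d e : Fin n → ℕ}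
    (T : (i : Fin n) → Matrix (L × Fin (d i)) (L × Fin (d i)) ℂ)
    (Q : (i : Fin n) → Matrix (Fin (e i) × R) (Fin (e i) × R) ℂ) :
    Matrix (L × BlockIndex d e × R) (L × BlockIndex d e × R) ℂ :=
  Matrix.reindex (blockEquiv L R d e) (blockEquiv L R d e)
    (Matrix.blockDiagonal' fun i => T i ⊗ₖ Q i)

/-- `σ` permutes equivalent blocks: blocks of equal dimensions `dim Dᵢ` and `dim Eᵢ`. -/
def PermutesEquivalent {n : ℕ} (d e : Fin n → ℕ) (σ : Equiv.Perm (Fin n)) : Prop :=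
  ∀ i, d (σ i) = d i ∧ e (σ i) = e i

/-- The operator on `⊕ᵢ Dᵢ ⊗ Eᵢ` that carries the basis vector `(i, a, b)` to `(σ i, a, b)`.
It is a permutation matrix when `σ` permutes equivalent blocks. -/
def blockPerm {n : ℕ} (d e : Fin n → ℕ) (σ : Equiv.Perm (Fin n)) :
    Matrix (BlockIndex d e) (BlockIndex d e) ℂ :=
  Matrix.of fun x y =>
    if x.1 = σ y.1 ∧ (x.2.1 : ℕ) = (y.2.1 : ℕ) ∧ (x.2.2 : ℕ) = (y.2.2 : ℕ) then 1 else 0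

/-- An operator on `L ⊗ (⊕ᵢ Dᵢ ⊗ Eᵢ) ⊗ R`, seen as an operator on `LCR`. -/
def BlockDecomposition.pullback {A : StarSubalgebra ℂ (Matrix C C ℂ)} (B : BlockDecomposition A)
    (X : Matrix (L × BlockIndex B.d B.e × R) (L × BlockIndex B.d B.e × R) ℂ) :
    Matrix (L × C × R) (L × C × R) ℂ :=
  (onMid L R B.Z)ᴴ * X * onMid L R B.Z

/-- The operator on `LCR` that applies `⊕ᵢ Tⁱ_{L Dᵢ} ⊗ Qⁱ_{Eᵢ R}` and then permutes the
blocks by `σ`. -/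
def BlockDecomposition.blockForm {A : StarSubalgebra ℂ (Matrix C C ℂ)} (B : BlockDecomposition A)
    (σ : Equiv.Perm (Fin B.n))
    (T : (i : Fin B.n) → Matrix (L × Fin (B.d i)) (L × Fin (B.d i)) ℂ)
    (Q : (i : Fin B.n) → Matrix (Fin (B.e i) × R) (Fin (B.e i) × R) ℂ) :
    Matrix (L × C × R) (L × C × R) ℂ :=
  B.pullback (onMid L R (blockPerm B.d B.e σ) * blockSum T Q)

/-- The operator on `LCR` that applies `tⁱ_{Dᵢ} ⊗ Qⁱ_{Eᵢ R}` on block `i` (and the identity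
on `L`), and then permutes the blocks by `π`. -/
def BlockDecomposition.rightLayer (L : Type*) [Fintype L] [DecidableEq L]
    {A : StarSubalgebra ℂ (Matrix C C ℂ)} (B : BlockDecomposition A)
    (π : Equiv.Perm (Fin B.n))
    (t : (i : Fin B.n) → Matrix (Fin (B.d i)) (Fin (B.d i)) ℂ)
    (Q : (i : Fin B.n) → Matrix (Fin (B.e i) × R) (Fin (B.e i) × R) ℂ) :
    Matrix (L × C × R) (L × C × R) ℂ :=
  B.pullback (onMid L R (blockPerm B.d B.e π) *
    blockSum (fun i => (1 : Matrix L L ℂ) ⊗ₖ t i) Q)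

/-- The operator on `LCR` that applies `Tⁱ_{L Dᵢ} ⊗ rⁱ_{Eᵢ}` (and the identity on `R`) on the
block `π i`, which is identified with block `i`, and then permutes the blocks by `ρ`. -/
def BlockDecomposition.leftLayer (R : Type*) [Fintype R] [DecidableEq R]
    {A : StarSubalgebra ℂ (Matrix C C ℂ)} (B : BlockDecomposition A)
    (ρ π : Equiv.Perm (Fin B.n))
    (T : (i : Fin B.n) → Matrix (L × Fin (B.d i)) (L × Fin (B.d i)) ℂ)
    (r : (i : Fin B.n) → Matrix (Fin (B.e i)) (Fin (B.e i)) ℂ) :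
    Matrix (L × C × R) (L × C × R) ℂ :=
  B.pullback (onMid L R (blockPerm B.d B.e ρ) *
    (onMid L R (blockPerm B.d B.e π) *
      blockSum T (fun i => r i ⊗ₖ (1 : Matrix R R ℂ)) *
      (onMid L R (blockPerm B.d B.e π))ᴴ))

end Systems

end WallUnitary

/-!
A left-wall `U` maps the algebra `N` generated by the evolved left operators into itself, hence
onto itself by finiteness of the dimension. Since `N` contains `M_L` and lies in `M_{LC} ⊗ 1_R`, it
contains all matrix entries of its elements with respect to `L`, so that `N = M_L ⊗ A ⊗ 1_R` with
`A = centralAlgebra U`; the algebra `A` is recovered from `N` by `onMid_mem_leftProduct_iff`.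

A star-algebra of matrices has a block decomposition (`nonempty_blockDecomposition`): the space is
an orthogonal sum of irreducible subspaces, Schur's lemma makes isomorphic ones unitarily equivalent
by operators in the commutant, and a basis transported along these equivalences is adapted to the
algebra (`AdaptedBasis`). That every block-diagonal operator occurs follows from the double
commutant theorem `mem_of_forall_commute`, a consequence of the Jacobson density theorem.

In a block basis `N` is `⊕ᵢ M_{L Dᵢ} ⊗ 1_{Eᵢ R}` (`BlockDecomposition.mem_leftProduct_iff`), and `U`
normalizes it. The structure theorem is therefore `exists_perm_tensor_of_normalizes`. Write the
block of `U` from block `i` to block `j` as a matrix, indexed by the bases of the `Eᵢ R`, of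
components `u : L Dᵢ → L Dⱼ`. Each component satisfies `u xᵢ = yⱼ u`, where either of `x`, `y` may be
prescribed. A nonzero component is thus invertible, nonzero components in one row or column of
blocks come from one block, and two of them in one block are proportional. So each row and column
has one nonzero block, and it is a tensor product.

Conversely, operators in block form normalize `N` by direct computation
(`BlockDecomposition.Ad_blockForm_image`), and every unitary that normalizes `N` is a left-wall. For
a brickwork wall, the layers prescribed by the block form multiply to the same operator as the given
layers; two such factorizations differ by an operator on both `LC` and `CR`, which acts on `C` alone
(`BlockDecomposition.exists_gauge`).
-/

namespace WallUnitary

set_option linter.unusedSectionVars false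

/-! ### Operators on subsystems -/

section Embeddings

variable {L C R : Type*} [Fintype L] [DecidableEq L] [Fintype C] [DecidableEq C]
  [Fintype R] [DecidableEq R]

theorem onLC_apply (m : Matrix (L × C) (L × C) ℂ) (x y : L × C × R) :
    onLC m x y = m (x.1, x.2.1) (y.1, y.2.1) * (1 : Matrix R R ℂ) x.2.2 y.2.2 := rfl

theorem onCR_apply (m : Matrix (C × R) (C × R) ℂ) (x y : L × C × R) :
    onCR m x y = (1 : Matrix L L ℂ) x.1 y.1 * m x.2 y.2 := rfl

theorem onMid_apply {C₁ C₂ : Type*} (g : Matrix C₁ C₂ ℂ) (x : L × C₁ × R) (y : L × C₂ × R) :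
    onMid L R g x y =
      (1 : Matrix L L ℂ) x.1 y.1 * (g x.2.1 y.2.1 * (1 : Matrix R R ℂ) x.2.2 y.2.2) := rfl

theorem onMid_mul {C₁ C₂ C₃ : Type*} [Fintype C₂] (g : Matrix C₁ C₂ ℂ) (h : Matrix C₂ C₃ ℂ) :
    onMid L R g * onMid L R h = onMid L R (g * h) := by
  simp only [onMid, ← Matrix.mul_kronecker_mul, one_mul]

theorem onMid_one : onMid L R (1 : Matrix C C ℂ) = 1 := by
  simp only [onMid, Matrix.one_kronecker_one]

theorem onMid_conjTranspose {C₁ C₂ : Type*} (g : Matrix C₁ C₂ ℂ) :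
    (onMid L R g)ᴴ = onMid L R gᴴ := by
  simp only [onMid, Matrix.conjTranspose_kronecker, Matrix.conjTranspose_one]

theorem onLC_mul (m m' : Matrix (L × C) (L × C) ℂ) :
    onLC (R := R) (m * m') = onLC m * onLC m' := by
  simp only [onLC, Matrix.reindex_apply, Matrix.submatrix_mul_equiv, ← Matrix.mul_kronecker_mul,
    one_mul]

theorem onLC_one : onLC (R := R) (1 : Matrix (L × C) (L × C) ℂ) = 1 := by
  simp only [onLC, Matrix.one_kronecker_one, Matrix.reindex_apply, Matrix.submatrix_one_equiv]

theorem onLC_conjTranspose (m : Matrix (L × C) (L × C) ℂ) :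
    (onLC (R := R) m)ᴴ = onLC mᴴ := by
  simp only [onLC, Matrix.reindex_apply, Matrix.conjTranspose_submatrix,
    Matrix.conjTranspose_kronecker, Matrix.conjTranspose_one]

theorem onLC_injective [Nonempty R] :
    Function.Injective (onLC : Matrix (L × C) (L × C) ℂ → Matrix (L × C × R) (L × C × R) ℂ) := by
  intro m m' h
  obtain ⟨r⟩ := ‹Nonempty R›
  ext ⟨l, c⟩ ⟨l', c'⟩
  simpa [onLC_apply] using congrFun (congrFun h (l, c, r)) (l', c', r)

theorem onCR_mul (m m' : Matrix (C × R) (C × R) ℂ) :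
    onCR (L := L) (m * m') = onCR m * onCR m' := by
  simp only [onCR, ← Matrix.mul_kronecker_mul, one_mul]

theorem onCR_one : onCR (L := L) (1 : Matrix (C × R) (C × R) ℂ) = 1 := by
  simp only [onCR, Matrix.one_kronecker_one]

theorem onCR_conjTranspose (m : Matrix (C × R) (C × R) ℂ) :
    (onCR (L := L) m)ᴴ = onCR mᴴ := by
  simp only [onCR, Matrix.conjTranspose_kronecker, Matrix.conjTranspose_one]

theorem onCR_injective [Nonempty L] :
    Function.Injective (onCR : Matrix (C × R) (C × R) ℂ → Matrix (L × C × R) (L × C × R) ℂ) := by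
  intro m m' h
  obtain ⟨l⟩ := ‹Nonempty L›
  ext x y
  simpa [onCR_apply] using congrFun (congrFun h (l, x)) (l, y)

theorem onMid_injective [Nonempty L] [Nonempty R] :
    Function.Injective (onMid L R : Matrix C C ℂ → Matrix (L × C × R) (L × C × R) ℂ) := by
  intro m m' h
  obtain ⟨l⟩ := ‹Nonempty L›
  obtain ⟨r⟩ := ‹Nonempty R›
  ext x y
  simpa [onMid_apply] using congrFun (congrFun h (l, x, r)) (l, y, r)

theorem onLC_one_kronecker (g : Matrix C C ℂ) :
    onLC (R := R) ((1 : Matrix L L ℂ) ⊗ₖ g) = onMid L R g := by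
  simp only [onLC, onMid, Matrix.kronecker_assoc]

theorem onCR_kronecker_one (g : Matrix C C ℂ) :
    onCR (L := L) (g ⊗ₖ (1 : Matrix R R ℂ)) = onMid L R g := rfl

theorem onLC_kronecker (m : Matrix L L ℂ) (g : Matrix C C ℂ) :
    onLC (R := R) (m ⊗ₖ g) = m ⊗ₖ (g ⊗ₖ (1 : Matrix R R ℂ)) := by
  simp only [onLC, Matrix.kronecker_assoc]

/-- An operator that acts both on `LC` only and on `CR` only acts on `C` only. -/
theorem exists_onMid_of_onLC_eq_onCR [Nonempty L] [Nonempty R] {m : Matrix (L × C) (L × C) ℂ}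
    {m' : Matrix (C × R) (C × R) ℂ} (h : onLC (R := R) m = onCR (L := L) m') :
    ∃ g : Matrix C C ℂ, m = 1 ⊗ₖ g ∧ m' = g ⊗ₖ 1 := by
  obtain ⟨l₀⟩ := ‹Nonempty L›
  obtain ⟨r₀⟩ := ‹Nonempty R›
  have key (l c r l' c' r') := congrFun (congrFun h (l, c, r)) (l', c', r')
  simp only [onLC_apply, onCR_apply] at key
  refine ⟨Matrix.of fun c c' => m' (c, r₀) (c', r₀), ?_, ?_⟩
  · ext ⟨l, c⟩ ⟨l', c'⟩
    simpa using key l c r₀ l' c' r₀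
  · ext ⟨c, r⟩ ⟨c', r'⟩
    have h1 := key l₀ c r l₀ c' r'
    have h2 := key l₀ c r₀ l₀ c' r₀
    simp only [Matrix.one_apply_eq, mul_one, one_mul] at h1 h2
    simp [← h1, ← h2]

theorem unitary_of_onLC [Nonempty R] {m : Matrix (L × C) (L × C) ℂ}
    (h : onLC (R := R) m ∈ Matrix.unitaryGroup (L × C × R) ℂ) :
    m ∈ Matrix.unitaryGroup (L × C) ℂ := by
  rw [Matrix.mem_unitaryGroup_iff, Matrix.star_eq_conjTranspose] at h ⊢
  apply onLC_injective (R := R)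
  rw [onLC_mul, ← onLC_conjTranspose, h, onLC_one]

theorem unitary_of_onCR [Nonempty L] {m : Matrix (C × R) (C × R) ℂ}
    (h : onCR (L := L) m ∈ Matrix.unitaryGroup (L × C × R) ℂ) :
    m ∈ Matrix.unitaryGroup (C × R) ℂ := by
  rw [Matrix.mem_unitaryGroup_iff, Matrix.star_eq_conjTranspose] at h ⊢
  apply onCR_injective (L := L)
  rw [onCR_mul, ← onCR_conjTranspose, h, onCR_one]

theorem onLC_mem_unitaryGroup {m : Matrix (L × C) (L × C) ℂ}
    (h : m ∈ Matrix.unitaryGroup (L × C) ℂ) :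
    onLC (R := R) m ∈ Matrix.unitaryGroup (L × C × R) ℂ := by
  rw [Matrix.mem_unitaryGroup_iff, Matrix.star_eq_conjTranspose] at h ⊢
  rw [onLC_conjTranspose, ← onLC_mul, h, onLC_one]

theorem onCR_mem_unitaryGroup {m : Matrix (C × R) (C × R) ℂ}
    (h : m ∈ Matrix.unitaryGroup (C × R) ℂ) :
    onCR (L := L) m ∈ Matrix.unitaryGroup (L × C × R) ℂ := by
  rw [Matrix.mem_unitaryGroup_iff, Matrix.star_eq_conjTranspose] at h ⊢
  rw [onCR_conjTranspose, ← onCR_mul, h, onCR_one]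

theorem unitary_of_onMid [Nonempty L] [Nonempty R] {g : Matrix C C ℂ}
    (h : onMid L R g ∈ Matrix.unitaryGroup (L × C × R) ℂ) : g ∈ Matrix.unitaryGroup C ℂ := by
  rw [Matrix.mem_unitaryGroup_iff, Matrix.star_eq_conjTranspose] at h ⊢
  apply onMid_injective (L := L) (R := R)
  rw [← onMid_mul, ← onMid_conjTranspose, h, onMid_one]

theorem onMid_mem_unitaryGroup {g : Matrix C C ℂ} (h : g ∈ Matrix.unitaryGroup C ℂ) :
    onMid L R g ∈ Matrix.unitaryGroup (L × C × R) ℂ := by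
  rw [Matrix.mem_unitaryGroup_iff, Matrix.star_eq_conjTranspose] at h ⊢
  rw [onMid_conjTranspose, onMid_mul, h, onMid_one]

end Embeddings

/-! ### Block sums -/

section Blocks

variable {L R : Type*} [Fintype L] [DecidableEq L] [Fintype R] [DecidableEq R]
  {n : ℕ} {d e : Fin n → ℕ}

theorem blockSum_mul (T T' : (i : Fin n) → Matrix (L × Fin (d i)) (L × Fin (d i)) ℂ)
    (Q Q' : (i : Fin n) → Matrix (Fin (e i) × R) (Fin (e i) × R) ℂ) :
    blockSum T Q * blockSum T' Q' = blockSum (fun i => T i * T' i) (fun i => Q i * Q' i) := by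
  simp only [blockSum, Matrix.reindex_apply, Matrix.submatrix_mul_equiv,
    ← Matrix.blockDiagonal'_mul, ← Matrix.mul_kronecker_mul]

theorem blockSum_one :
    blockSum (fun i => (1 : Matrix (L × Fin (d i)) (L × Fin (d i)) ℂ))
      (fun i => (1 : Matrix (Fin (e i) × R) (Fin (e i) × R) ℂ)) = 1 := by
  simp only [blockSum, Matrix.one_kronecker_one]
  have := Matrix.blockDiagonal'_one (α := ℂ) (m' := fun i => (L × Fin (d i)) × (Fin (e i) × R))
  rw [Pi.one_def] at this
  rw [this, Matrix.reindex_apply, Matrix.submatrix_one_equiv]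

theorem blockSum_conjTranspose (T : (i : Fin n) → Matrix (L × Fin (d i)) (L × Fin (d i)) ℂ)
    (Q : (i : Fin n) → Matrix (Fin (e i) × R) (Fin (e i) × R) ℂ) :
    (blockSum T Q)ᴴ = blockSum (fun i => (T i)ᴴ) (fun i => (Q i)ᴴ) := by
  simp only [blockSum, Matrix.reindex_apply, Matrix.conjTranspose_submatrix,
    Matrix.blockDiagonal'_conjTranspose, Matrix.conjTranspose_kronecker]

theorem blockSum_mem_unitaryGroup
    {T : (i : Fin n) → Matrix (L × Fin (d i)) (L × Fin (d i)) ℂ}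
    {Q : (i : Fin n) → Matrix (Fin (e i) × R) (Fin (e i) × R) ℂ}
    (hT : ∀ i, T i ∈ Matrix.unitaryGroup (L × Fin (d i)) ℂ)
    (hQ : ∀ i, Q i ∈ Matrix.unitaryGroup (Fin (e i) × R) ℂ) :
    blockSum T Q ∈ Matrix.unitaryGroup (L × BlockIndex d e × R) ℂ := by
  simp only [Matrix.mem_unitaryGroup_iff, Matrix.star_eq_conjTranspose] at hT hQ ⊢
  simp only [blockSum_conjTranspose, blockSum_mul, hT, hQ, blockSum_one]

theorem blockSum_apply_eq (T : (i : Fin n) → Matrix (L × Fin (d i)) (L × Fin (d i)) ℂ)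
    (Q : (i : Fin n) → Matrix (Fin (e i) × R) (Fin (e i) × R) ℂ) (i : Fin n)
    (l l' : L) (a a' : Fin (d i)) (b b' : Fin (e i)) (r r' : R) :
    blockSum T Q (l, ⟨i, a, b⟩, r) (l', ⟨i, a', b'⟩, r') =
      T i (l, a) (l', a') * Q i (b, r) (b', r') := by
  simp [blockSum, blockEquiv, Matrix.blockDiagonal'_apply_eq]

theorem blockSum_apply_ne (T : (i : Fin n) → Matrix (L × Fin (d i)) (L × Fin (d i)) ℂ)
    (Q : (i : Fin n) → Matrix (Fin (e i) × R) (Fin (e i) × R) ℂ) {i j : Fin n} (h : i ≠ j)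
    (l l' : L) (x : Fin (d i) × Fin (e i)) (y : Fin (d j) × Fin (e j)) (r r' : R) :
    blockSum T Q (l, ⟨i, x⟩, r) (l', ⟨j, y⟩, r') = 0 := by
  simp [blockSum, blockEquiv, Matrix.blockDiagonal'_apply_ne _ _ _ h]

theorem kronecker_blockDiagonal' (m : Matrix L L ℂ)
    (x : (i : Fin n) → Matrix (Fin (d i)) (Fin (d i)) ℂ) :
    m ⊗ₖ ((Matrix.blockDiagonal' fun i => x i ⊗ₖ (1 : Matrix (Fin (e i)) (Fin (e i)) ℂ)) ⊗ₖ
      (1 : Matrix R R ℂ)) = blockSum (fun i => m ⊗ₖ x i) (fun _ => 1) := by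
  ext ⟨l, ⟨i, a, b⟩, r⟩ ⟨l', ⟨j, a', b'⟩, r'⟩
  by_cases h : i = j
  · subst h
    simp only [blockSum_apply_eq, Matrix.blockDiagonal'_apply_eq,
      Matrix.kronecker_apply, ← Matrix.one_kronecker_one (m := Fin (e i)) (n := R)]
    ring
  · simp [blockSum_apply_ne _ _ h, Matrix.blockDiagonal'_apply_ne _ _ _ h]

/-- The operator `⊕ᵢ Tⁱ ⊗ yⁱ` on `L ⊗ (⊕ᵢ Dᵢ ⊗ Eᵢ)`. -/
def blockSumLeft (T : (i : Fin n) → Matrix (L × Fin (d i)) (L × Fin (d i)) ℂ)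
    (y : (i : Fin n) → Matrix (Fin (e i)) (Fin (e i)) ℂ) :
    Matrix (L × BlockIndex d e) (L × BlockIndex d e) ℂ :=
  Matrix.of fun p q => Matrix.blockDiagonal' (fun i => T i ⊗ₖ y i)
    ⟨p.2.1, (p.1, p.2.2.1), p.2.2.2⟩ ⟨q.2.1, (q.1, q.2.2.1), q.2.2.2⟩

theorem onLC_blockSumLeft (T : (i : Fin n) → Matrix (L × Fin (d i)) (L × Fin (d i)) ℂ)
    (y : (i : Fin n) → Matrix (Fin (e i)) (Fin (e i)) ℂ) :
    onLC (R := R) (blockSumLeft T y) = blockSum T (fun i => y i ⊗ₖ (1 : Matrix R R ℂ)) := by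
  ext ⟨l, ⟨i, a, b⟩, r⟩ ⟨l', ⟨j, a', b'⟩, r'⟩
  by_cases h : i = j
  · subst h
    simp only [blockSum_apply_eq, onLC_apply, blockSumLeft, Matrix.of_apply,
      Matrix.blockDiagonal'_apply_eq, Matrix.kronecker_apply]
    ring
  · simp [blockSum_apply_ne _ _ h, onLC_apply, blockSumLeft, Matrix.blockDiagonal'_apply_ne _ _ _ h]

/-- The operator `⊕ᵢ xⁱ ⊗ Qⁱ` on `(⊕ᵢ Dᵢ ⊗ Eᵢ) ⊗ R`. -/
def blockSumRight (x : (i : Fin n) → Matrix (Fin (d i)) (Fin (d i)) ℂ)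
    (Q : (i : Fin n) → Matrix (Fin (e i) × R) (Fin (e i) × R) ℂ) :
    Matrix (BlockIndex d e × R) (BlockIndex d e × R) ℂ :=
  Matrix.of fun p q => Matrix.blockDiagonal' (fun i => x i ⊗ₖ Q i)
    ⟨p.1.1, p.1.2.1, (p.1.2.2, p.2)⟩ ⟨q.1.1, q.1.2.1, (q.1.2.2, q.2)⟩

theorem onCR_blockSumRight (x : (i : Fin n) → Matrix (Fin (d i)) (Fin (d i)) ℂ)
    (Q : (i : Fin n) → Matrix (Fin (e i) × R) (Fin (e i) × R) ℂ) :
    onCR (L := L) (blockSumRight x Q) = blockSum (fun i => (1 : Matrix L L ℂ) ⊗ₖ x i) Q := by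
  ext ⟨l, ⟨i, a, b⟩, r⟩ ⟨l', ⟨j, a', b'⟩, r'⟩
  by_cases h : i = j
  · subst h
    simp only [blockSum_apply_eq, onCR_apply, blockSumRight, Matrix.of_apply,
      Matrix.blockDiagonal'_apply_eq, Matrix.kronecker_apply]
    ring
  · simp [blockSum_apply_ne _ _ h, onCR_apply, blockSumRight,
      Matrix.blockDiagonal'_apply_ne _ _ _ h]

/-! ### Permutations of equivalent blocks -/

/-- The permutation `(i, a, b) ↦ (σ i, a, b)` of basis labels, for `σ` permuting equivalent
blocks. -/
def blockMap {σ : Equiv.Perm (Fin n)} (hσ : PermutesEquivalent d e σ) :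
    BlockIndex d e ≃ BlockIndex d e :=
  Equiv.sigmaCongr σ fun i => Equiv.prodCongr (finCongr (hσ i).1.symm) (finCongr (hσ i).2.symm)

theorem blockMap_mk {σ : Equiv.Perm (Fin n)} (hσ : PermutesEquivalent d e σ) (i : Fin n)
    (a : Fin (d i)) (b : Fin (e i)) :
    blockMap hσ ⟨i, a, b⟩ = ⟨σ i, Fin.cast (hσ i).1.symm a, Fin.cast (hσ i).2.symm b⟩ := rfl

theorem blockIndex_eq_iff (x y : BlockIndex d e) :
    x = y ↔ x.1 = y.1 ∧ (x.2.1 : ℕ) = (y.2.1 : ℕ) ∧ (x.2.2 : ℕ) = (y.2.2 : ℕ) := by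
  obtain ⟨i, a, b⟩ := x
  obtain ⟨j, a', b'⟩ := y
  constructor
  · rintro h
    cases h
    simp
  · rintro ⟨h1, h2, h3⟩
    dsimp only at h1 h2 h3
    subst h1
    rw [Fin.ext h2, Fin.ext h3]

theorem blockPerm_eq {σ : Equiv.Perm (Fin n)} (hσ : PermutesEquivalent d e σ) :
    blockPerm d e σ = (1 : Matrix (BlockIndex d e) (BlockIndex d e) ℂ).submatrix id
      (blockMap hσ) := by
  ext x ⟨j, a, b⟩
  simp only [blockPerm, Matrix.of_apply, Matrix.submatrix_apply, id, Matrix.one_apply,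
    blockIndex_eq_iff]
  rfl

theorem PermutesEquivalent.mul {σ τ : Equiv.Perm (Fin n)} (hσ : PermutesEquivalent d e σ)
    (hτ : PermutesEquivalent d e τ) : PermutesEquivalent d e (σ * τ) := fun i =>
  ⟨(hσ (τ i)).1.trans (hτ i).1, (hσ (τ i)).2.trans (hτ i).2⟩

theorem mul_blockPerm {σ : Equiv.Perm (Fin n)} (hσ : PermutesEquivalent d e σ)
    {m : Type*} (X : Matrix m (BlockIndex d e) ℂ) :
    X * blockPerm d e σ = X.submatrix id (blockMap hσ) := by
  rw [blockPerm_eq hσ]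
  ext x y
  simp [Matrix.mul_apply, Matrix.one_apply]

theorem blockPerm_mul_blockPerm {σ τ : Equiv.Perm (Fin n)} (hσ : PermutesEquivalent d e σ)
    (hτ : PermutesEquivalent d e τ) :
    blockPerm d e σ * blockPerm d e τ = blockPerm d e (σ * τ) := by
  rw [mul_blockPerm hτ, blockPerm_eq hσ, blockPerm_eq (hσ.mul hτ)]
  rfl

theorem blockPerm_mem_unitaryGroup {σ : Equiv.Perm (Fin n)} (hσ : PermutesEquivalent d e σ) :
    blockPerm d e σ ∈ Matrix.unitaryGroup (BlockIndex d e) ℂ := by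
  rw [Matrix.mem_unitaryGroup_iff', Matrix.star_eq_conjTranspose, mul_blockPerm hσ,
    blockPerm_eq hσ, Matrix.conjTranspose_submatrix, Matrix.conjTranspose_one,
    Matrix.submatrix_submatrix]
  exact Matrix.submatrix_one_equiv (blockMap hσ)

end Blocks

/-! ### Change to the block basis -/

section Pullback

variable {L C R : Type*} [Fintype L] [DecidableEq L] [Fintype C] [DecidableEq C]
  [Fintype R] [DecidableEq R] {A : StarSubalgebra ℂ (Matrix C C ℂ)} (B : BlockDecomposition A)

theorem BlockDecomposition.onMid_Z_mul :
    onMid L R B.Z * (onMid L R B.Z)ᴴ = 1 := by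
  rw [onMid_conjTranspose, onMid_mul, B.Z_mul_star, onMid_one]

theorem BlockDecomposition.mul_onMid_Z :
    (onMid L R B.Z)ᴴ * onMid L R B.Z = 1 := by
  rw [onMid_conjTranspose, onMid_mul, B.star_mul_Z, onMid_one]

theorem BlockDecomposition.pullback_mul
    (X Y : Matrix (L × BlockIndex B.d B.e × R) (L × BlockIndex B.d B.e × R) ℂ) :
    B.pullback (X * Y) = B.pullback X * B.pullback Y := by
  simp only [pullback, Matrix.mul_assoc]
  rw [← Matrix.mul_assoc (onMid L R B.Z) (onMid L R B.Z)ᴴ, B.onMid_Z_mul, Matrix.one_mul]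

theorem BlockDecomposition.pullback_one :
    B.pullback (1 : Matrix (L × BlockIndex B.d B.e × R) (L × BlockIndex B.d B.e × R) ℂ) = 1 := by
  rw [pullback, Matrix.mul_one, B.mul_onMid_Z]

theorem BlockDecomposition.pullback_conjTranspose
    (X : Matrix (L × BlockIndex B.d B.e × R) (L × BlockIndex B.d B.e × R) ℂ) :
    (B.pullback X)ᴴ = B.pullback Xᴴ := by
  simp only [pullback, Matrix.conjTranspose_mul, Matrix.conjTranspose_conjTranspose,
    Matrix.mul_assoc]

/-- An operator on `LCR`, seen on `L ⊗ (⊕ᵢ Dᵢ ⊗ Eᵢ) ⊗ R`; inverse to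
`BlockDecomposition.pullback`. -/
def BlockDecomposition.push (X : Matrix (L × C × R) (L × C × R) ℂ) :
    Matrix (L × BlockIndex B.d B.e × R) (L × BlockIndex B.d B.e × R) ℂ :=
  onMid L R B.Z * X * (onMid L R B.Z)ᴴ

theorem BlockDecomposition.pullback_push (X : Matrix (L × C × R) (L × C × R) ℂ) :
    B.pullback (B.push X) = X := by
  simp only [pullback, push, Matrix.mul_assoc]
  rw [B.mul_onMid_Z, Matrix.mul_one, ← Matrix.mul_assoc, B.mul_onMid_Z, Matrix.one_mul]

theorem BlockDecomposition.push_pullback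
    (X : Matrix (L × BlockIndex B.d B.e × R) (L × BlockIndex B.d B.e × R) ℂ) :
    B.push (B.pullback X) = X := by
  simp only [pullback, push, Matrix.mul_assoc]
  rw [B.onMid_Z_mul, Matrix.mul_one, ← Matrix.mul_assoc, B.onMid_Z_mul, Matrix.one_mul]

theorem BlockDecomposition.pullback_injective :
    Function.Injective (B.pullback (L := L) (R := R)) :=
  Function.LeftInverse.injective B.push_pullback

theorem BlockDecomposition.pullback_mem_unitaryGroup
    {X : Matrix (L × BlockIndex B.d B.e × R) (L × BlockIndex B.d B.e × R) ℂ} :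
    B.pullback X ∈ Matrix.unitaryGroup (L × C × R) ℂ ↔
      X ∈ Matrix.unitaryGroup (L × BlockIndex B.d B.e × R) ℂ := by
  rw [Matrix.mem_unitaryGroup_iff, Matrix.mem_unitaryGroup_iff, Matrix.star_eq_conjTranspose,
    Matrix.star_eq_conjTranspose, B.pullback_conjTranspose, ← B.pullback_mul,
    ← B.pullback_one (L := L) (R := R), B.pullback_injective.eq_iff]

theorem BlockDecomposition.pullback_onLC
    (m : Matrix (L × BlockIndex B.d B.e) (L × BlockIndex B.d B.e) ℂ) :
    B.pullback (onLC (R := R) m) =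
      onLC (((1 : Matrix L L ℂ) ⊗ₖ B.Z)ᴴ * m * ((1 : Matrix L L ℂ) ⊗ₖ B.Z)) := by
  have h : onMid L R B.Z = Matrix.reindex (Equiv.prodAssoc L (BlockIndex B.d B.e) R)
      (Equiv.prodAssoc L C R) (((1 : Matrix L L ℂ) ⊗ₖ B.Z) ⊗ₖ (1 : Matrix R R ℂ)) := by
    rw [Matrix.kronecker_assoc]; rfl
  simp only [pullback, h, onLC, Matrix.reindex_apply, Matrix.conjTranspose_submatrix,
    Matrix.submatrix_mul_equiv, Matrix.conjTranspose_kronecker _ (1 : Matrix R R ℂ),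
    Matrix.conjTranspose_one, ← Matrix.mul_kronecker_mul, one_mul]

theorem BlockDecomposition.pullback_onCR
    (m : Matrix (BlockIndex B.d B.e × R) (BlockIndex B.d B.e × R) ℂ) :
    B.pullback (onCR (L := L) m) =
      onCR ((B.Z ⊗ₖ (1 : Matrix R R ℂ))ᴴ * m * (B.Z ⊗ₖ (1 : Matrix R R ℂ))) := by
  simp only [pullback, onMid, onCR, Matrix.conjTranspose_kronecker (1 : Matrix L L ℂ),
    Matrix.conjTranspose_one, ← Matrix.mul_kronecker_mul, one_mul]

end Pullback

/-! ### The adjoint action -/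

section Adjoint

variable {S : Type*} [Fintype S] [DecidableEq S]

theorem Ad_mul {U : Matrix S S ℂ} (hU : U ∈ Matrix.unitaryGroup S ℂ) (X Y : Matrix S S ℂ) :
    Ad U (X * Y) = Ad U X * Ad U Y := by
  rw [Matrix.mem_unitaryGroup_iff', Matrix.star_eq_conjTranspose] at hU
  simp only [Ad, Matrix.mul_assoc]
  rw [← Matrix.mul_assoc Uᴴ U, hU, Matrix.one_mul]

theorem Ad_conjTranspose (U X : Matrix S S ℂ) : (Ad U X)ᴴ = Ad U Xᴴ := by
  simp only [Ad, Matrix.conjTranspose_mul, Matrix.conjTranspose_conjTranspose, Matrix.mul_assoc]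

theorem Ad_conjTranspose_Ad {U : Matrix S S ℂ} (hU : U ∈ Matrix.unitaryGroup S ℂ)
    (X : Matrix S S ℂ) : Ad Uᴴ (Ad U X) = X := by
  rw [Matrix.mem_unitaryGroup_iff', Matrix.star_eq_conjTranspose] at hU
  simp only [Ad, Matrix.mul_assoc, Matrix.conjTranspose_conjTranspose]
  rw [hU, Matrix.mul_one, ← Matrix.mul_assoc, hU, Matrix.one_mul]

theorem Ad_Ad_conjTranspose {U : Matrix S S ℂ} (hU : U ∈ Matrix.unitaryGroup S ℂ)
    (X : Matrix S S ℂ) : Ad U (Ad Uᴴ X) = X := by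
  have := Ad_conjTranspose_Ad (Unitary.star_mem hU) X
  rwa [Matrix.star_eq_conjTranspose, Matrix.conjTranspose_conjTranspose] at this

theorem conjTranspose_mem_unitaryGroup {U : Matrix S S ℂ} (hU : U ∈ Matrix.unitaryGroup S ℂ) :
    Uᴴ ∈ Matrix.unitaryGroup S ℂ := Unitary.star_mem hU

/-- A space of operators that is stable under `Ad U` is mapped onto itself, because its dimension
is finite. -/
theorem Ad_image_eq_of_mapsTo {U : Matrix S S ℂ} (hU : U ∈ Matrix.unitaryGroup S ℂ)
    (N : Submodule ℂ (Matrix S S ℂ)) (h : ∀ X ∈ N, Ad U X ∈ N) :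
    Ad U '' (N : Set (Matrix S S ℂ)) = N := by
  let f : Matrix S S ℂ →ₗ[ℂ] Matrix S S ℂ :=
    (LinearMap.mulRight ℂ Uᴴ).comp (LinearMap.mulLeft ℂ U)
  have hf : ∀ X, f X = Ad U X := fun X => rfl
  have hinj : Function.Injective f := fun X Y hXY => by
    rw [← Ad_conjTranspose_Ad hU X, ← Ad_conjTranspose_Ad hU Y, ← hf, ← hf, hXY]
  have hle : N.map f ≤ N := by
    rintro _ ⟨X, hX, rfl⟩
    exact h X hX
  have heq : N.map f = N :=
    Submodule.eq_of_le_of_finrank_eq hle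
      (LinearEquiv.finrank_eq (Submodule.equivMapOfInjective f hinj N)).symm
  exact congrArg (fun M : Submodule ℂ (Matrix S S ℂ) => (M : Set (Matrix S S ℂ))) heq

/-- Stability under the inverse of `Ad U` suffices as well. -/
theorem Ad_image_eq_of_mapsTo_inv {U : Matrix S S ℂ} (hU : U ∈ Matrix.unitaryGroup S ℂ)
    (N : Submodule ℂ (Matrix S S ℂ)) (h : ∀ X ∈ N, Ad Uᴴ X ∈ N) :
    Ad U '' (N : Set (Matrix S S ℂ)) = N := by
  have h1 := Ad_image_eq_of_mapsTo (conjTranspose_mem_unitaryGroup hU) N h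
  conv_lhs => rw [← h1]
  rw [Set.image_image]
  simp only [Ad_Ad_conjTranspose hU, Set.image_id']

end Adjoint

/-! ### Operator spaces of the form `M_L ⊗ A ⊗ 1_R` -/

section LeftProduct

variable {L C R : Type*} [Fintype L] [DecidableEq L] [Fintype C] [DecidableEq C]
  [Fintype R] [DecidableEq R]

theorem onL_mem_leftProduct (A : StarSubalgebra ℂ (Matrix C C ℂ)) (m : Matrix L L ℂ) :
    onL m ∈ leftProduct L R A :=
  Submodule.subset_span ⟨m, 1, one_mem A, by rw [onL, Matrix.one_kronecker_one]⟩

theorem exists_onLC_of_mem_leftProduct {A : StarSubalgebra ℂ (Matrix C C ℂ)}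
    {X : Matrix (L × C × R) (L × C × R) ℂ} (hX : X ∈ leftProduct L R A) :
    ∃ m, X = onLC m := by
  induction hX using Submodule.span_induction with
  | mem X hX =>
    obtain ⟨m, a, -, rfl⟩ := hX
    exact ⟨m ⊗ₖ a, (onLC_kronecker m a).symm⟩
  | zero => exact ⟨0, by ext; simp [onLC_apply]⟩
  | add X Y _ _ hX hY =>
    obtain ⟨m, rfl⟩ := hX
    obtain ⟨m', rfl⟩ := hY
    exact ⟨m + m', by ext; simp [onLC_apply, add_mul]⟩
  | smul c X _ hX =>
    obtain ⟨m, rfl⟩ := hX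
    exact ⟨c • m, by ext; simp [onLC_apply, mul_assoc]⟩

theorem onMid_mem_leftProduct_iff [Nonempty L] [Nonempty R]
    {A : StarSubalgebra ℂ (Matrix C C ℂ)} {a : Matrix C C ℂ} :
    onMid L R a ∈ leftProduct L R A ↔ a ∈ A := by
  constructor
  · obtain ⟨l⟩ := ‹Nonempty L›
    obtain ⟨r⟩ := ‹Nonempty R›
    intro h
    -- the compression to a fixed basis vector of `L` and of `R` maps `M_L ⊗ A ⊗ 1` into `A`
    have key : ∀ X ∈ leftProduct L R A,
        X.submatrix (fun c => (l, c, r)) (fun c => (l, c, r)) ∈ A := by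
      intro X hX
      induction hX using Submodule.span_induction with
      | mem X hX =>
        obtain ⟨m, a, ha, rfl⟩ := hX
        have hs : (m ⊗ₖ (a ⊗ₖ (1 : Matrix R R ℂ))).submatrix (fun c => (l, c, r))
            (fun c => (l, c, r)) = m l l • a := by ext; simp
        rw [hs]
        exact A.toSubalgebra.smul_mem ha (m l l)
      | zero => exact zero_mem A
      | add X Y _ _ hX hY => exact add_mem hX hY
      | smul c X _ hX => exact A.toSubalgebra.smul_mem hX c
    convert key _ h using 1
    ext; simp [onMid_apply]
  · exact fun h => Submodule.subset_span ⟨1, a, h, rfl⟩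

theorem leftProduct_injective [Nonempty L] [Nonempty R] :
    Function.Injective (leftProduct L R : StarSubalgebra ℂ (Matrix C C ℂ) → _) := by
  intro A A' h
  ext a
  rw [← onMid_mem_leftProduct_iff (L := L) (R := R), h, onMid_mem_leftProduct_iff]

theorem isLeftWall_of_mapsTo_leftProduct {U : Matrix (L × C × R) (L × C × R) ℂ}
    (A : StarSubalgebra ℂ (Matrix C C ℂ))
    (h : ∀ X ∈ leftProduct L R A, Ad U X ∈ leftProduct L R A) : IsLeftWall U := by
  intro t m
  apply exists_onLC_of_mem_leftProduct (A := A)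
  exact Set.MapsTo.iterate (s := (leftProduct L R A : Set _)) (fun X hX => h X hX) t
    (onL_mem_leftProduct A m)

theorem blockSum_sum_left {n : ℕ} {d e : Fin n → ℕ} {ι : Type*} (s : Finset ι)
    (x : ι → (i : Fin n) → Matrix (L × Fin (d i)) (L × Fin (d i)) ℂ)
    (Q : (i : Fin n) → Matrix (Fin (e i) × R) (Fin (e i) × R) ℂ) :
    blockSum (fun i => ∑ k ∈ s, x k i) Q = ∑ k ∈ s, blockSum (x k) Q := by
  ext ⟨l, ⟨i, a, b⟩, r⟩ ⟨l', ⟨j, a', b'⟩, r'⟩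
  by_cases h : i = j
  · subst h
    simp only [blockSum_apply_eq, Matrix.sum_apply, Finset.sum_mul]
  · simp only [blockSum_apply_ne _ _ h, Matrix.sum_apply, Finset.sum_const_zero]

theorem blockSum_zero_left {n : ℕ} {d e : Fin n → ℕ}
    (Q : (i : Fin n) → Matrix (Fin (e i) × R) (Fin (e i) × R) ℂ) :
    blockSum (d := d) (fun i => (0 : Matrix (L × Fin (d i)) (L × Fin (d i)) ℂ)) Q = 0 := by
  simpa using blockSum_sum_left (d := d) (∅ : Finset ℕ) (fun _ _ => 0) Q

theorem blockSum_add_left {n : ℕ} {d e : Fin n → ℕ}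
    (x y : (i : Fin n) → Matrix (L × Fin (d i)) (L × Fin (d i)) ℂ)
    (Q : (i : Fin n) → Matrix (Fin (e i) × R) (Fin (e i) × R) ℂ) :
    blockSum (fun i => x i + y i) Q = blockSum x Q + blockSum y Q := by
  simpa using blockSum_sum_left Finset.univ (fun k : Bool => if k then x else y) Q

theorem blockSum_smul_left {n : ℕ} {d e : Fin n → ℕ} (c : ℂ)
    (x : (i : Fin n) → Matrix (L × Fin (d i)) (L × Fin (d i)) ℂ)
    (Q : (i : Fin n) → Matrix (Fin (e i) × R) (Fin (e i) × R) ℂ) :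
    blockSum (fun i => c • x i) Q = c • blockSum x Q := by
  ext ⟨l, ⟨i, a, b⟩, r⟩ ⟨l', ⟨j, a', b'⟩, r'⟩
  by_cases h : i = j
  · subst h
    simp [blockSum_apply_eq, mul_assoc]
  · simp [blockSum_apply_ne _ _ h]

theorem BlockDecomposition.pullback_add {A : StarSubalgebra ℂ (Matrix C C ℂ)}
    (B : BlockDecomposition A)
    (X Y : Matrix (L × BlockIndex B.d B.e × R) (L × BlockIndex B.d B.e × R) ℂ) :
    B.pullback (X + Y) = B.pullback X + B.pullback Y := by
  simp only [pullback, Matrix.mul_add, Matrix.add_mul]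

theorem BlockDecomposition.pullback_smul {A : StarSubalgebra ℂ (Matrix C C ℂ)}
    (B : BlockDecomposition A) (c : ℂ)
    (X : Matrix (L × BlockIndex B.d B.e × R) (L × BlockIndex B.d B.e × R) ℂ) :
    B.pullback (c • X) = c • B.pullback X := by
  simp only [pullback, Matrix.mul_smul, Matrix.smul_mul]

theorem BlockDecomposition.pullback_zero {A : StarSubalgebra ℂ (Matrix C C ℂ)}
    (B : BlockDecomposition A) :
    B.pullback (0 : Matrix (L × BlockIndex B.d B.e × R) (L × BlockIndex B.d B.e × R) ℂ) = 0 := by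
  simp only [pullback, Matrix.mul_zero, Matrix.zero_mul]

theorem BlockDecomposition.exists_kronecker_eq_pullback {A : StarSubalgebra ℂ (Matrix C C ℂ)}
    (B : BlockDecomposition A) {a : Matrix C C ℂ} (ha : a ∈ A) (m : Matrix L L ℂ) :
    ∃ x : (i : Fin B.n) → Matrix (L × Fin (B.d i)) (L × Fin (B.d i)) ℂ,
      m ⊗ₖ (a ⊗ₖ (1 : Matrix R R ℂ)) = B.pullback (blockSum x fun _ => 1) := by
  obtain ⟨x, hx⟩ := (B.mem_iff a).1 ha
  refine ⟨fun i => m ⊗ₖ x i, ?_⟩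
  rw [← kronecker_blockDiagonal', ← hx, ← B.pullback_push (m ⊗ₖ (a ⊗ₖ (1 : Matrix R R ℂ)))]
  congr 1
  simp only [push, onMid, Matrix.conjTranspose_kronecker, Matrix.conjTranspose_one,
    ← Matrix.mul_kronecker_mul, one_mul, mul_one]

/-- In the block basis, `M_L ⊗ A ⊗ 1_R` is `⊕ᵢ M_{L Dᵢ} ⊗ 1_{Eᵢ R}`. -/
theorem BlockDecomposition.mem_leftProduct_iff {A : StarSubalgebra ℂ (Matrix C C ℂ)}
    (B : BlockDecomposition A) {X : Matrix (L × C × R) (L × C × R) ℂ} :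
    X ∈ leftProduct L R A ↔
      ∃ x : (i : Fin B.n) → Matrix (L × Fin (B.d i)) (L × Fin (B.d i)) ℂ,
        X = B.pullback (blockSum x fun _ => 1) := by
  constructor
  · intro hX
    induction hX using Submodule.span_induction with
    | mem X hX =>
      obtain ⟨m, a, ha, rfl⟩ := hX
      exact B.exists_kronecker_eq_pullback ha m
    | zero => exact ⟨fun _ => 0, by rw [blockSum_zero_left, B.pullback_zero]⟩
    | add X Y _ _ hX hY =>
      obtain ⟨x, rfl⟩ := hX
      obtain ⟨y, rfl⟩ := hY
      exact ⟨fun i => x i + y i, by rw [blockSum_add_left, B.pullback_add]⟩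
    | smul c X _ hX =>
      obtain ⟨x, rfl⟩ := hX
      exact ⟨fun i => c • x i, by rw [blockSum_smul_left, B.pullback_smul]⟩
  · rintro ⟨x, rfl⟩
    -- expand `x` in the matrix units of `L`
    let x' : L → L → (i : Fin B.n) → Matrix (Fin (B.d i)) (Fin (B.d i)) ℂ :=
      fun l l' i => (x i).submatrix (Prod.mk l) (Prod.mk l')
    have hx : x = fun i => ∑ k : L × L, Matrix.single k.1 k.2 (1 : ℂ) ⊗ₖ x' k.1 k.2 i := by
      funext i
      ext ⟨l, a⟩ ⟨l', a'⟩
      rw [Matrix.sum_apply, Finset.sum_eq_single (l, l')]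
      · simp [x']
      · rintro ⟨k, k'⟩ - hk
        rw [Matrix.kronecker_apply, Matrix.single_apply, if_neg, zero_mul]
        rintro ⟨rfl, rfl⟩
        exact hk rfl
      · simp
    have hsum : B.pullback (blockSum x fun _ => (1 : Matrix (Fin (B.e _) × R) _ ℂ)) =
        ∑ k : L × L, B.pullback (blockSum (fun i => Matrix.single k.1 k.2 (1 : ℂ) ⊗ₖ x' k.1 k.2 i)
          fun _ => 1) := by
      conv_lhs => rw [hx]
      rw [blockSum_sum_left]
      simp only [pullback, Matrix.mul_sum, Matrix.sum_mul]
    rw [hsum]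
    refine Submodule.sum_mem _ fun k _ => Submodule.subset_span
      ⟨Matrix.single k.1 k.2 1, B.Zᴴ * (Matrix.blockDiagonal' fun i =>
        x' k.1 k.2 i ⊗ₖ (1 : Matrix (Fin (B.e i)) (Fin (B.e i)) ℂ)) * B.Z, ?_, ?_⟩
    · refine (B.mem_iff _).2 ⟨x' k.1 k.2, ?_⟩
      simp only [Matrix.mul_assoc]
      rw [B.Z_mul_star, Matrix.mul_one, ← Matrix.mul_assoc, B.Z_mul_star, Matrix.one_mul]
    · rw [← kronecker_blockDiagonal']
      simp only [pullback, onMid, Matrix.conjTranspose_kronecker, Matrix.conjTranspose_one,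
        ← Matrix.mul_kronecker_mul, one_mul, mul_one]

end LeftProduct

/-! ### Left-walls in block form -/

section BlockForm

variable {L C R : Type*} [Fintype L] [DecidableEq L] [Fintype C] [DecidableEq C]
  [Fintype R] [DecidableEq R] {A : StarSubalgebra ℂ (Matrix C C ℂ)} (B : BlockDecomposition A)

theorem onMid_blockPerm {n : ℕ} {d e : Fin n → ℕ} {σ : Equiv.Perm (Fin n)}
    (hσ : PermutesEquivalent d e σ) :
    onMid L R (blockPerm d e σ) =
      (1 : Matrix (L × BlockIndex d e × R) (L × BlockIndex d e × R) ℂ).submatrix id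
        (Prod.map id (Prod.map (blockMap hσ) id)) := by
  rw [blockPerm_eq hσ, ← onMid_one]
  rfl

theorem conjTranspose_blockPerm_mul {n : ℕ} {d e : Fin n → ℕ} {σ : Equiv.Perm (Fin n)}
    (hσ : PermutesEquivalent d e σ)
    (X : Matrix (L × BlockIndex d e × R) (L × BlockIndex d e × R) ℂ) :
    (onMid L R (blockPerm d e σ))ᴴ * X =
      X.submatrix (Prod.map id (Prod.map (blockMap hσ) id)) id := by
  rw [onMid_blockPerm hσ]
  ext x y
  simp [Matrix.mul_apply, Matrix.one_apply]

/-- Conjugation by the inverse of a block permutation relabels the blocks. -/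
theorem conj_blockPerm {n : ℕ} {d e : Fin n → ℕ} {σ : Equiv.Perm (Fin n)}
    (hσ : PermutesEquivalent d e σ)
    (X : Matrix (L × BlockIndex d e × R) (L × BlockIndex d e × R) ℂ) :
    (onMid L R (blockPerm d e σ))ᴴ * X * onMid L R (blockPerm d e σ) =
      X.submatrix (Prod.map id (Prod.map (blockMap hσ) id))
        (Prod.map id (Prod.map (blockMap hσ) id)) := by
  rw [conjTranspose_blockPerm_mul hσ, onMid_blockPerm hσ]
  ext x y
  simp [Matrix.mul_apply, Matrix.one_apply]

theorem conj_blockPerm_blockSum_one {n : ℕ} {d e : Fin n → ℕ} {σ : Equiv.Perm (Fin n)}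
    (hσ : PermutesEquivalent d e σ)
    (x : (i : Fin n) → Matrix (L × Fin (d i)) (L × Fin (d i)) ℂ) :
    (onMid L R (blockPerm d e σ))ᴴ * blockSum x (fun _ => 1) * onMid L R (blockPerm d e σ) =
      blockSum (fun i => (x (σ i)).submatrix (Prod.map id (Fin.cast (hσ i).1.symm))
        (Prod.map id (Fin.cast (hσ i).1.symm))) (fun _ => 1) := by
  rw [conj_blockPerm hσ]
  ext ⟨l, ⟨i, a, b⟩, r⟩ ⟨l', ⟨j, a', b'⟩, r'⟩
  by_cases h : i = j
  · subst h
    simp [blockMap_mk, blockSum_apply_eq, Matrix.one_apply]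
  · have h' : σ i ≠ σ j := fun hij => h (σ.injective hij)
    simp [blockMap_mk, blockSum_apply_ne _ _ h, blockSum_apply_ne _ _ h']

theorem BlockDecomposition.blockForm_mem_unitaryGroup {σ : Equiv.Perm (Fin B.n)}
    (hσ : PermutesEquivalent B.d B.e σ)
    {T : (i : Fin B.n) → Matrix (L × Fin (B.d i)) (L × Fin (B.d i)) ℂ}
    {Q : (i : Fin B.n) → Matrix (Fin (B.e i) × R) (Fin (B.e i) × R) ℂ}
    (hT : ∀ i, T i ∈ Matrix.unitaryGroup (L × Fin (B.d i)) ℂ)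
    (hQ : ∀ i, Q i ∈ Matrix.unitaryGroup (Fin (B.e i) × R) ℂ) :
    B.blockForm σ T Q ∈ Matrix.unitaryGroup (L × C × R) ℂ :=
  B.pullback_mem_unitaryGroup.2
    (mul_mem (onMid_mem_unitaryGroup (blockPerm_mem_unitaryGroup hσ))
      (blockSum_mem_unitaryGroup hT hQ))

theorem BlockDecomposition.Ad_blockForm_image {σ : Equiv.Perm (Fin B.n)}
    (hσ : PermutesEquivalent B.d B.e σ)
    {T : (i : Fin B.n) → Matrix (L × Fin (B.d i)) (L × Fin (B.d i)) ℂ}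
    {Q : (i : Fin B.n) → Matrix (Fin (B.e i) × R) (Fin (B.e i) × R) ℂ}
    (hT : ∀ i, T i ∈ Matrix.unitaryGroup (L × Fin (B.d i)) ℂ)
    (hQ : ∀ i, Q i ∈ Matrix.unitaryGroup (Fin (B.e i) × R) ℂ) :
    Ad (B.blockForm σ T Q) '' (leftProduct L R A : Set _) = (leftProduct L R A : Set _) := by
  refine Ad_image_eq_of_mapsTo_inv (B.blockForm_mem_unitaryGroup hσ hT hQ) _ fun X hX => ?_
  obtain ⟨x, rfl⟩ := B.mem_leftProduct_iff.1 hX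
  refine B.mem_leftProduct_iff.2 ⟨fun i => (T i)ᴴ *
    (x (σ i)).submatrix (Prod.map id (Fin.cast (hσ i).1.symm))
        (Prod.map id (Fin.cast (hσ i).1.symm)) * T i, ?_⟩
  have hQ' : ∀ i, (Q i)ᴴ * 1 * Q i = 1 := fun i => by
    rw [Matrix.mul_one]
    exact Matrix.mem_unitaryGroup_iff'.1 (hQ i)
  rw [Ad, Matrix.conjTranspose_conjTranspose, blockForm, B.pullback_conjTranspose,
    ← B.pullback_mul, ← B.pullback_mul]
  congr 1
  have h := conj_blockPerm_blockSum_one (L := L) (R := R) hσ x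
  calc _ = (blockSum T Q)ᴴ * ((onMid L R (blockPerm B.d B.e σ))ᴴ * blockSum x (fun _ => 1) *
        onMid L R (blockPerm B.d B.e σ)) * blockSum T Q := by
        simp only [Matrix.conjTranspose_mul, Matrix.mul_assoc]
    _ = _ := by
        rw [h, blockSum_conjTranspose, blockSum_mul, blockSum_mul]
        simp only [hQ']

theorem BlockDecomposition.isLeftWall_blockForm {σ : Equiv.Perm (Fin B.n)}
    (hσ : PermutesEquivalent B.d B.e σ)
    {T : (i : Fin B.n) → Matrix (L × Fin (B.d i)) (L × Fin (B.d i)) ℂ}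
    {Q : (i : Fin B.n) → Matrix (Fin (B.e i) × R) (Fin (B.e i) × R) ℂ}
    (hT : ∀ i, T i ∈ Matrix.unitaryGroup (L × Fin (B.d i)) ℂ)
    (hQ : ∀ i, Q i ∈ Matrix.unitaryGroup (Fin (B.e i) × R) ℂ) :
    IsLeftWall (B.blockForm σ T Q) :=
  isLeftWall_of_mapsTo_leftProduct A fun X hX => by
    have h := Set.mem_image_of_mem (Ad (B.blockForm σ T Q)) (SetLike.mem_coe.2 hX)
    rwa [B.Ad_blockForm_image hσ hT hQ] at h

end BlockForm

/-! ### Brickwork layers -/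

section Layers

variable {L C R : Type*} [Fintype L] [DecidableEq L] [Fintype C] [DecidableEq C]
  [Fintype R] [DecidableEq R] {A : StarSubalgebra ℂ (Matrix C C ℂ)} (B : BlockDecomposition A)

theorem BlockDecomposition.exists_onLC_eq_leftLayer {ρ π : Equiv.Perm (Fin B.n)}
    (T : (i : Fin B.n) → Matrix (L × Fin (B.d i)) (L × Fin (B.d i)) ℂ)
    (r : (i : Fin B.n) → Matrix (Fin (B.e i)) (Fin (B.e i)) ℂ) :
    ∃ V, onLC V = B.leftLayer R ρ π T r := by
  simp only [leftLayer, ← onLC_blockSumLeft, ← onLC_one_kronecker, onLC_conjTranspose,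
    ← onLC_mul, pullback_onLC]
  exact ⟨_, rfl⟩

theorem BlockDecomposition.exists_onCR_eq_rightLayer {π : Equiv.Perm (Fin B.n)}
    (t : (i : Fin B.n) → Matrix (Fin (B.d i)) (Fin (B.d i)) ℂ)
    (Q : (i : Fin B.n) → Matrix (Fin (B.e i) × R) (Fin (B.e i) × R) ℂ) :
    ∃ W, onCR W = B.rightLayer L π t Q := by
  simp only [rightLayer, ← onCR_blockSumRight, ← onCR_kronecker_one, ← onCR_mul, pullback_onCR]
  exact ⟨_, rfl⟩

theorem one_kronecker_mem_unitaryGroup {m k : Type*} [Fintype m] [DecidableEq m] [Fintype k]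
    [DecidableEq k] {t : Matrix k k ℂ} (h : t ∈ Matrix.unitaryGroup k ℂ) :
    (1 : Matrix m m ℂ) ⊗ₖ t ∈ Matrix.unitaryGroup (m × k) ℂ :=
  Matrix.kronecker_mem_unitary (one_mem _) h

theorem kronecker_one_mem_unitaryGroup {m k : Type*} [Fintype m] [DecidableEq m] [Fintype k]
    [DecidableEq k] {t : Matrix k k ℂ} (h : t ∈ Matrix.unitaryGroup k ℂ) :
    t ⊗ₖ (1 : Matrix m m ℂ) ∈ Matrix.unitaryGroup (k × m) ℂ :=
  Matrix.kronecker_mem_unitary h (one_mem _)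

theorem BlockDecomposition.leftLayer_mem_unitaryGroup {ρ π : Equiv.Perm (Fin B.n)}
    (hρ : PermutesEquivalent B.d B.e ρ) (hπ : PermutesEquivalent B.d B.e π)
    {T : (i : Fin B.n) → Matrix (L × Fin (B.d i)) (L × Fin (B.d i)) ℂ}
    {r : (i : Fin B.n) → Matrix (Fin (B.e i)) (Fin (B.e i)) ℂ}
    (hT : ∀ i, T i ∈ Matrix.unitaryGroup (L × Fin (B.d i)) ℂ)
    (hr : ∀ i, r i ∈ Matrix.unitaryGroup (Fin (B.e i)) ℂ) :
    B.leftLayer R ρ π T r ∈ Matrix.unitaryGroup (L × C × R) ℂ :=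
  B.pullback_mem_unitaryGroup.2
    (mul_mem (onMid_mem_unitaryGroup (blockPerm_mem_unitaryGroup hρ))
      (mul_mem (mul_mem (onMid_mem_unitaryGroup (blockPerm_mem_unitaryGroup hπ))
        (blockSum_mem_unitaryGroup hT fun i => kronecker_one_mem_unitaryGroup (hr i)))
        (conjTranspose_mem_unitaryGroup
          (onMid_mem_unitaryGroup (blockPerm_mem_unitaryGroup hπ)))))

theorem BlockDecomposition.rightLayer_mem_unitaryGroup {π : Equiv.Perm (Fin B.n)}
    (hπ : PermutesEquivalent B.d B.e π)
    {t : (i : Fin B.n) → Matrix (Fin (B.d i)) (Fin (B.d i)) ℂ}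
    {Q : (i : Fin B.n) → Matrix (Fin (B.e i) × R) (Fin (B.e i) × R) ℂ}
    (ht : ∀ i, t i ∈ Matrix.unitaryGroup (Fin (B.d i)) ℂ)
    (hQ : ∀ i, Q i ∈ Matrix.unitaryGroup (Fin (B.e i) × R) ℂ) :
    B.rightLayer L π t Q ∈ Matrix.unitaryGroup (L × C × R) ℂ :=
  B.pullback_mem_unitaryGroup.2
    (mul_mem (onMid_mem_unitaryGroup (blockPerm_mem_unitaryGroup hπ))
      (blockSum_mem_unitaryGroup (fun i => one_kronecker_mem_unitaryGroup (ht i)) hQ))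

/-- The inner block permutations of the two layers cancel, so that a product of layers is again in
block form. -/
theorem BlockDecomposition.leftLayer_mul_rightLayer {ρ π : Equiv.Perm (Fin B.n)}
    (hρ : PermutesEquivalent B.d B.e ρ) (hπ : PermutesEquivalent B.d B.e π)
    (T : (i : Fin B.n) → Matrix (L × Fin (B.d i)) (L × Fin (B.d i)) ℂ)
    (r : (i : Fin B.n) → Matrix (Fin (B.e i)) (Fin (B.e i)) ℂ)
    (t : (i : Fin B.n) → Matrix (Fin (B.d i)) (Fin (B.d i)) ℂ)
    (Q : (i : Fin B.n) → Matrix (Fin (B.e i) × R) (Fin (B.e i) × R) ℂ) :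
    B.leftLayer R ρ π T r * B.rightLayer L π t Q =
      B.blockForm (ρ * π) (fun i => T i * ((1 : Matrix L L ℂ) ⊗ₖ t i))
        (fun i => (r i ⊗ₖ (1 : Matrix R R ℂ)) * Q i) := by
  have h : (onMid L R (blockPerm B.d B.e π))ᴴ * onMid L R (blockPerm B.d B.e π) = 1 :=
    Matrix.mem_unitaryGroup_iff'.1 (onMid_mem_unitaryGroup (blockPerm_mem_unitaryGroup hπ))
  rw [leftLayer, rightLayer, blockForm, ← B.pullback_mul, ← blockPerm_mul_blockPerm hρ hπ,
    ← onMid_mul, ← blockSum_mul]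
  congr 1
  simp only [Matrix.mul_assoc]
  rw [← Matrix.mul_assoc (onMid L R (blockPerm B.d B.e π))ᴴ, h, Matrix.one_mul]

/-- A brickwork unitary in block form factors into layers in block form, up to a gauge unitary on
the central system: two factorizations of one operator into a factor on `LC` and a factor on `CR`
differ by an operator on `LC` and `CR`, hence on `C`. -/
theorem BlockDecomposition.exists_gauge [Nonempty L] [Nonempty R]
    {V : Matrix (L × C) (L × C) ℂ} {W : Matrix (C × R) (C × R) ℂ}
    (hV : V ∈ Matrix.unitaryGroup (L × C) ℂ) (hW : W ∈ Matrix.unitaryGroup (C × R) ℂ)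
    {ρ π : Equiv.Perm (Fin B.n)}
    (hρ : PermutesEquivalent B.d B.e ρ) (hπ : PermutesEquivalent B.d B.e π)
    {T : (i : Fin B.n) → Matrix (L × Fin (B.d i)) (L × Fin (B.d i)) ℂ}
    {r : (i : Fin B.n) → Matrix (Fin (B.e i)) (Fin (B.e i)) ℂ}
    {t : (i : Fin B.n) → Matrix (Fin (B.d i)) (Fin (B.d i)) ℂ}
    {Q : (i : Fin B.n) → Matrix (Fin (B.e i) × R) (Fin (B.e i) × R) ℂ}
    (hT : ∀ i, T i ∈ Matrix.unitaryGroup (L × Fin (B.d i)) ℂ)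
    (hr : ∀ i, r i ∈ Matrix.unitaryGroup (Fin (B.e i)) ℂ)
    (h : onLC V * onCR W = B.leftLayer R ρ π T r * B.rightLayer L π t Q) :
    ∃ G ∈ Matrix.unitaryGroup C ℂ,
      onLC (V * ((1 : Matrix L L ℂ) ⊗ₖ G⁻¹)) = B.leftLayer R ρ π T r ∧
      onCR ((G ⊗ₖ (1 : Matrix R R ℂ)) * W) = B.rightLayer L π t Q := by
  obtain ⟨V', hV'⟩ := B.exists_onLC_eq_leftLayer (R := R) (ρ := ρ) (π := π) T r
  obtain ⟨W', hW'⟩ := B.exists_onCR_eq_rightLayer (L := L) (π := π) t Q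
  have hV'u : V' ∈ Matrix.unitaryGroup (L × C) ℂ :=
    unitary_of_onLC (R := R) (hV' ▸ B.leftLayer_mem_unitaryGroup hρ hπ hT hr)
  rw [← hV', ← hW'] at h ⊢
  have hV1 : Vᴴ * V = 1 := Matrix.mem_unitaryGroup_iff'.1 hV
  have hV'1 : V'ᴴ * V' = 1 := Matrix.mem_unitaryGroup_iff'.1 hV'u
  have hV'2 : V' * V'ᴴ = 1 := Matrix.mem_unitaryGroup_iff.1 hV'u
  have hW1 : W * Wᴴ = 1 := Matrix.mem_unitaryGroup_iff.1 hW
  have hW2 : Wᴴ * W = 1 := Matrix.mem_unitaryGroup_iff'.1 hW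
  have key : onLC (R := R) (V'ᴴ * V) = onCR (L := L) (W' * Wᴴ) := by
    rw [onLC_mul, onCR_mul]
    calc _ = onLC V'ᴴ * (onLC V * onCR W) * onCR Wᴴ := by
          rw [Matrix.mul_assoc, Matrix.mul_assoc (onLC V), ← onCR_mul, hW1, onCR_one,
            Matrix.mul_one]
      _ = _ := by
          rw [h, ← Matrix.mul_assoc, ← onLC_mul, hV'1, onLC_one, Matrix.one_mul]
  obtain ⟨G, hG1, hG2⟩ := exists_onMid_of_onLC_eq_onCR key
  have hG : G ∈ Matrix.unitaryGroup C ℂ := by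
    apply unitary_of_onMid (L := L) (R := R)
    rw [← onLC_one_kronecker, ← hG1]
    exact onLC_mem_unitaryGroup (mul_mem (conjTranspose_mem_unitaryGroup hV'u) hV)
  refine ⟨G, hG, ?_, ?_⟩
  · have hinv : G⁻¹ = Gᴴ := Matrix.inv_eq_left_inv (Matrix.mem_unitaryGroup_iff'.1 hG)
    have : (1 : Matrix L L ℂ) ⊗ₖ Gᴴ = Vᴴ * V' := by
      have := congrArg Matrix.conjTranspose hG1
      rw [Matrix.conjTranspose_mul, Matrix.conjTranspose_conjTranspose,
        Matrix.conjTranspose_kronecker, Matrix.conjTranspose_one] at this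
      exact this.symm
    have hV2 : V * Vᴴ = 1 := Matrix.mem_unitaryGroup_iff.1 hV
    rw [hinv, this, ← Matrix.mul_assoc, hV2, Matrix.one_mul]
  · rw [← hG2, Matrix.mul_assoc, hW2, Matrix.mul_one]

end Layers

/-! ### The algebra generated by the evolved left operators -/

section Closure

variable {L C R : Type*} [Fintype L] [DecidableEq L] [Fintype C] [DecidableEq C]
  [Fintype R] [DecidableEq R] {U : Matrix (L × C × R) (L × C × R) ℂ}

theorem onL_mem_leftClosure (m : Matrix L L ℂ) : onL m ∈ leftClosure U :=
  Algebra.subset_adjoin ⟨0, m, rfl⟩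

theorem onL_conjTranspose (m : Matrix L L ℂ) :
    (onL m : Matrix (L × C × R) (L × C × R) ℂ)ᴴ = onL mᴴ := by
  rw [onL, Matrix.conjTranspose_kronecker, Matrix.conjTranspose_one, onL]

theorem Ad_iterate_conjTranspose (t : ℕ) (X : Matrix (L × C × R) (L × C × R) ℂ) :
    ((Ad U)^[t] X)ᴴ = (Ad U)^[t] Xᴴ := by
  induction t generalizing X with
  | zero => rfl
  | succ t ih => rw [Function.iterate_succ_apply, Function.iterate_succ_apply, ih,
      Ad_conjTranspose]

theorem conjTranspose_mem_leftClosure {X : Matrix (L × C × R) (L × C × R) ℂ}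
    (hX : X ∈ leftClosure U) : Xᴴ ∈ leftClosure U := by
  induction hX using Algebra.adjoin_induction with
  | mem X hX =>
    obtain ⟨t, m, rfl⟩ := hX
    exact Algebra.subset_adjoin ⟨t, mᴴ, by rw [Ad_iterate_conjTranspose, onL_conjTranspose]⟩
  | algebraMap c =>
    rw [← Matrix.star_eq_conjTranspose, ← algebraMap_star_comm]
    exact (leftClosure U).algebraMap_mem _
  | add X Y _ _ hX hY =>
    rw [Matrix.conjTranspose_add]
    exact add_mem hX hY
  | mul X Y _ _ hX hY =>
    rw [Matrix.conjTranspose_mul]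
    exact mul_mem hY hX

theorem Ad_mem_leftClosure (hU : U ∈ Matrix.unitaryGroup (L × C × R) ℂ)
    {X : Matrix (L × C × R) (L × C × R) ℂ}
    (hX : X ∈ leftClosure U) : Ad U X ∈ leftClosure U := by
  induction hX using Algebra.adjoin_induction with
  | mem X hX =>
    obtain ⟨t, m, rfl⟩ := hX
    exact Algebra.subset_adjoin ⟨t + 1, m, by rw [Function.iterate_succ_apply']⟩
  | algebraMap c =>
    have : Ad U (algebraMap ℂ _ c) = algebraMap ℂ _ c := by
      rw [Ad, ← Algebra.commutes, Matrix.mul_assoc]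
      rw [← Matrix.star_eq_conjTranspose, Matrix.mem_unitaryGroup_iff.1 hU, Matrix.mul_one]
    rw [this]
    exact (leftClosure U).algebraMap_mem _
  | add X Y _ _ hX hY =>
    rw [Ad, Matrix.mul_add, Matrix.add_mul]
    exact add_mem hX hY
  | mul X Y _ _ hX hY =>
    rw [Ad_mul hU]
    exact mul_mem hX hY

theorem IsLeftWall.exists_onLC_of_mem_leftClosure (hU : IsLeftWall U)
    {X : Matrix (L × C × R) (L × C × R) ℂ} (hX : X ∈ leftClosure U) : ∃ m, X = onLC m := by
  induction hX using Algebra.adjoin_induction with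
  | mem X hX =>
    obtain ⟨t, m, rfl⟩ := hX
    exact hU t m
  | algebraMap c =>
    refine ⟨c • 1, ?_⟩
    rw [Algebra.algebraMap_eq_smul_one, ← onLC_one]
    ext
    simp [onLC_apply, mul_assoc]
  | add X Y _ _ hX hY =>
    obtain ⟨m, rfl⟩ := hX
    obtain ⟨m', rfl⟩ := hY
    exact ⟨m + m', by ext; simp [onLC_apply, add_mul]⟩
  | mul X Y _ _ hX hY =>
    obtain ⟨m, rfl⟩ := hX
    obtain ⟨m', rfl⟩ := hY
    exact ⟨m * m', (onLC_mul m m').symm⟩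

/-- The operators on the central system that belong to the algebra generated by the evolved left
operators. -/
def centralAlgebra (U : Matrix (L × C × R) (L × C × R) ℂ) : StarSubalgebra ℂ (Matrix C C ℂ) where
  carrier := {a | onMid L R a ∈ leftClosure U}
  mul_mem' {a b} ha hb := by
    rw [Set.mem_ofPred_eq, ← onMid_mul]
    exact mul_mem ha hb
  one_mem' := by
    rw [Set.mem_ofPred_eq, onMid_one]
    exact one_mem _
  add_mem' {a b} ha hb := by
    have : onMid L R (a + b) = onMid L R a + onMid L R b := by
      ext; simp only [onMid_apply, Matrix.add_apply]; ring
    rw [Set.mem_ofPred_eq, this]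
    exact add_mem ha hb
  zero_mem' := by
    have : onMid L R (0 : Matrix C C ℂ) = 0 := by ext; simp [onMid_apply]
    rw [Set.mem_ofPred_eq, this]
    exact zero_mem _
  algebraMap_mem' c := by
    have : onMid L R (algebraMap ℂ (Matrix C C ℂ) c) = algebraMap ℂ _ c := by
      rw [Algebra.algebraMap_eq_smul_one, Algebra.algebraMap_eq_smul_one, ← onMid_one]
      ext; simp only [onMid_apply, Matrix.smul_apply, smul_eq_mul]; ring
    rw [Set.mem_ofPred_eq, this]
    exact (leftClosure U).algebraMap_mem _
  star_mem' {a} ha := by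
    rw [Set.mem_ofPred_eq, Matrix.star_eq_conjTranspose, ← onMid_conjTranspose]
    exact conjTranspose_mem_leftClosure ha

theorem mem_centralAlgebra {a : Matrix C C ℂ} :
    a ∈ centralAlgebra U ↔ onMid L R a ∈ leftClosure U := Iff.rfl

/-- The algebra contains `M_L`, so that it contains with an operator all its matrix entries with
respect to `L`. -/
theorem IsLeftWall.hasInvariantAlgebra_centralAlgebra (hU : IsLeftWall U) :
    HasInvariantAlgebra U (centralAlgebra U) := by
  apply le_antisymm
  · intro X hX
    rw [Subalgebra.mem_toSubmodule] at hX
    obtain ⟨m, rfl⟩ := hU.exists_onLC_of_mem_leftClosure hX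
    have hslice : ∀ l l' : L, m.submatrix (Prod.mk l) (Prod.mk l') ∈ centralAlgebra U := by
      intro l l'
      have h : onMid L R (m.submatrix (Prod.mk l) (Prod.mk l')) =
          ∑ k : L, onL (Matrix.single k l 1) * onLC m * onL (Matrix.single l' k 1) := by
        ext ⟨x, c, r⟩ ⟨y, c', r'⟩
        have h1 (k l : L) : (onL (Matrix.single k l (1 : ℂ)) : Matrix (L × C × R) (L × C × R) ℂ) =
            onLC (Matrix.single k l (1 : ℂ) ⊗ₖ (1 : Matrix C C ℂ)) := by
          rw [onLC_kronecker, Matrix.one_kronecker_one, onL]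
        simp only [h1, ← onLC_mul, Matrix.sum_apply, onLC_apply, onMid_apply, Matrix.mul_apply,
          Fintype.sum_prod_type, Matrix.kronecker_apply, Matrix.single_apply, Matrix.one_apply,
          Matrix.submatrix_apply]
        by_cases hxy : x = y
        · subst hxy
          simp [ite_and]
        · simp [ite_and, hxy]
          exact fun _ h => absurd h.symm hxy
      rw [mem_centralAlgebra, h]
      exact sum_mem fun k _ => mul_mem (mul_mem (onL_mem_leftClosure _) hX)
        (onL_mem_leftClosure _)
    have hm : (onLC m : Matrix (L × C × R) (L × C × R) ℂ) = ∑ k : L × L,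
        Matrix.single k.1 k.2 (1 : ℂ) ⊗ₖ
          (m.submatrix (Prod.mk k.1) (Prod.mk k.2) ⊗ₖ (1 : Matrix R R ℂ)) := by
      ext ⟨x, c, r⟩ ⟨y, c', r'⟩
      rw [Matrix.sum_apply, Finset.sum_eq_single (x, y)]
      · simp [onLC_apply]
      · rintro ⟨k, k'⟩ - hk
        rw [Matrix.kronecker_apply, Matrix.single_apply, if_neg, zero_mul]
        rintro ⟨rfl, rfl⟩
        exact hk rfl
      · simp
    rw [hm]
    exact Submodule.sum_mem _ fun k _ => Submodule.subset_span ⟨_, _, hslice _ _, rfl⟩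
  · refine Submodule.span_le.2 ?_
    rintro _ ⟨m, a, ha, rfl⟩
    rw [SetLike.mem_coe, Subalgebra.mem_toSubmodule]
    have : m ⊗ₖ (a ⊗ₖ (1 : Matrix R R ℂ)) = onL m * onMid L R a := by
      rw [onL, onMid, ← Matrix.mul_kronecker_mul, Matrix.mul_one, Matrix.one_mul]
    rw [this]
    exact mul_mem (onL_mem_leftClosure m) ha

theorem HasInvariantAlgebra.Ad_image (hU : U ∈ Matrix.unitaryGroup (L × C × R) ℂ)
    {A : StarSubalgebra ℂ (Matrix C C ℂ)} (hA : HasInvariantAlgebra U A) :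
    Ad U '' (leftProduct L R A : Set _) = (leftProduct L R A : Set _) := by
  refine Ad_image_eq_of_mapsTo hU _ fun X hX => ?_
  rw [← hA, Subalgebra.mem_toSubmodule] at hX ⊢
  exact Ad_mem_leftClosure hU hX

theorem IsLeftWall.existsUnique_hasInvariantAlgebra [Nonempty L] [Nonempty R]
    (hU : IsLeftWall U) : ∃! A : StarSubalgebra ℂ (Matrix C C ℂ), HasInvariantAlgebra U A :=
  ⟨centralAlgebra U, hU.hasInvariantAlgebra_centralAlgebra, fun _ hA =>
    leftProduct_injective (hA.symm.trans hU.hasInvariantAlgebra_centralAlgebra)⟩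

end Closure

/-! ### Invariant subspaces of a star-algebra of operators -/

section Operators

variable {H : Type*} [NormedAddCommGroup H] [InnerProductSpace ℂ H] [FiniteDimensional ℂ H]
  [CompleteSpace H] {𝒜 : StarSubalgebra ℂ (H →L[ℂ] H)}

/-- `W` is mapped into itself by every operator in `𝒜`. -/
def IsInvariant (𝒜 : StarSubalgebra ℂ (H →L[ℂ] H)) (W : Submodule ℂ H) : Prop :=
  ∀ f ∈ 𝒜, ∀ v ∈ W, f v ∈ W

/-- `W` is a minimal nonzero subspace among those invariant under `𝒜`. -/
structure IsIrreducible (𝒜 : StarSubalgebra ℂ (H →L[ℂ] H)) (W : Submodule ℂ H) : Prop where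
  invariant : IsInvariant 𝒜 W
  ne_bot : W ≠ ⊥
  eq_of_le : ∀ W' ≤ W, IsInvariant 𝒜 W' → W' ≠ ⊥ → W' = W

/-- The operators that commute with every operator in `𝒜`. -/
noncomputable def commutant (𝒜 : StarSubalgebra ℂ (H →L[ℂ] H)) : StarSubalgebra ℂ (H →L[ℂ] H) :=
  StarSubalgebra.centralizer ℂ (𝒜 : Set (H →L[ℂ] H))

theorem mem_commutant_iff {g : H →L[ℂ] H} :
    g ∈ commutant 𝒜 ↔ ∀ f ∈ 𝒜, ∀ v, f (g v) = g (f v) := by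
  rw [commutant, StarSubalgebra.mem_centralizer_iff]
  constructor
  · intro h f hf v
    exact DFunLike.congr_fun (h f hf).1 v
  · exact fun h f hf => ⟨ContinuousLinearMap.ext (h f hf),
      ContinuousLinearMap.ext (h _ (star_mem (SetLike.mem_coe.1 hf)))⟩

theorem IsInvariant.orthogonal {W : Submodule ℂ H} (hW : IsInvariant 𝒜 W) :
    IsInvariant 𝒜 Wᗮ := by
  intro f hf v hv w hw
  rw [← ContinuousLinearMap.adjoint_inner_left]
  exact hv _ (hW _ (star_mem hf) w hw)

theorem IsInvariant.inf {W W' : Submodule ℂ H} (hW : IsInvariant 𝒜 W) (hW' : IsInvariant 𝒜 W') :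
    IsInvariant 𝒜 (W ⊓ W') :=
  fun f hf v hv => ⟨hW f hf v hv.1, hW' f hf v hv.2⟩

theorem IsInvariant.starProjection_mem_commutant {W : Submodule ℂ H} (hW : IsInvariant 𝒜 W) :
    W.starProjection ∈ commutant 𝒜 := by
  refine mem_commutant_iff.2 fun f hf v => ?_
  refine (Submodule.eq_starProjection_of_mem_orthogonal
    (hW f hf _ (W.starProjection_apply_mem v)) ?_).symm
  rw [← map_sub]
  exact hW.orthogonal f hf _ (Submodule.sub_starProjection_mem_orthogonal v)

theorem IsInvariant.map {W : Submodule ℂ H} (hW : IsInvariant 𝒜 W) {g : H →L[ℂ] H}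
    (hg : g ∈ commutant 𝒜) : IsInvariant 𝒜 (W.map (g : H →ₗ[ℂ] H)) := by
  rintro f hf _ ⟨v, hv, rfl⟩
  exact ⟨f v, hW f hf v hv, (mem_commutant_iff.1 hg f hf v).symm⟩

theorem IsInvariant.exists_isIrreducible_le {W : Submodule ℂ H} (hW : IsInvariant 𝒜 W)
    (h0 : W ≠ ⊥) : ∃ V ≤ W, IsIrreducible 𝒜 V := by
  obtain ⟨V, ⟨hVW, hV, hV0⟩, hmin⟩ := wellFounded_lt.has_min
    {V : Submodule ℂ H | V ≤ W ∧ IsInvariant 𝒜 V ∧ V ≠ ⊥} ⟨W, le_rfl, hW, h0⟩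
  refine ⟨V, hVW, hV, hV0, fun W' hle hinv hne => ?_⟩
  by_contra hW'
  exact hmin W' ⟨hle.trans hVW, hinv, hne⟩ (lt_of_le_of_ne hle hW')

/-- Complete reducibility: an invariant subspace is an orthogonal sum of irreducible ones. -/
theorem IsInvariant.exists_orthogonal_decomposition {W : Submodule ℂ H} (hW : IsInvariant 𝒜 W) :
    ∃ (m : ℕ) (V : Fin m → Submodule ℂ H), (∀ k, IsIrreducible 𝒜 (V k)) ∧
      (∀ k k', k ≠ k' → V k ⟂ V k') ∧ ⨆ k, V k = W := by
  induction W using WellFoundedLT.induction with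
  | ind W ih =>
  by_cases h0 : W = ⊥
  · exact ⟨0, Fin.elim0, fun k => k.elim0, fun k => k.elim0, by rw [iSup_of_empty, h0]⟩
  obtain ⟨V₀, hV₀W, hV₀⟩ := hW.exists_isIrreducible_le h0
  have hsup : V₀ ⊔ V₀ᗮ ⊓ W = W := Submodule.sup_orthogonal_inf_of_hasOrthogonalProjection hV₀W
  have hlt : V₀ᗮ ⊓ W < W := by
    refine lt_of_le_of_ne inf_le_right fun h => hV₀.ne_bot ?_
    rw [← Submodule.isOrtho_self]
    exact Submodule.isOrtho_iff_le.2 (hV₀W.trans (inf_eq_right.1 h))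
  obtain ⟨m, V, hirr, horth, hV⟩ := ih _ hlt (hV₀.invariant.orthogonal.inf hW)
  have hV₀V : ∀ k, V₀ ⟂ V k := fun k =>
    Submodule.IsOrtho.symm (Submodule.isOrtho_iff_le.2
      ((le_iSup V k).trans (hV.le.trans inf_le_left)))
  refine ⟨m + 1, Fin.cons V₀ V, fun k => ?_, fun k k' => ?_, ?_⟩
  · refine Fin.cases hV₀ hirr k
  · refine Fin.cases ?_ (fun k => ?_) k <;> refine Fin.cases ?_ (fun k' => ?_) k'
    · exact fun h => absurd rfl h
    · exact fun _ => hV₀V k'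
    · exact fun _ => (hV₀V k).symm
    · exact fun h => horth k k' fun hk => h (congrArg Fin.succ hk)
  · rw [← hsup]
    refine le_antisymm (iSup_le fun k => ?_) (sup_le ?_ ?_)
    · refine Fin.cases le_sup_left (fun k => ?_) k
      exact ((le_iSup V k).trans hV.le).trans le_sup_right
    · exact le_iSup (Fin.cons V₀ V : Fin (m + 1) → Submodule ℂ H) 0
    · rw [← hV]
      exact iSup_le fun k => le_iSup (Fin.cons V₀ V : Fin (m + 1) → Submodule ℂ H) k.succ

/-- Schur's lemma: the compression of an operator in the commutant to an irreducible subspace is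
scalar. -/
theorem IsIrreducible.exists_scalar {V : Submodule ℂ H} (hV : IsIrreducible 𝒜 V)
    {g : H →L[ℂ] H} (hg : g ∈ commutant 𝒜) :
    ∃ c : ℂ, ∀ v ∈ V, V.starProjection (g v) = c • v := by
  let g' : V →ₗ[ℂ] V := ((V.starProjection * g : H →L[ℂ] H) : H →ₗ[ℂ] H).restrict
    fun v _ => V.starProjection_apply_mem (g v)
  have : Nontrivial V := Submodule.nontrivial_iff_ne_bot.2 hV.ne_bot
  obtain ⟨c, hc⟩ := Module.End.exists_eigenvalue g'
  obtain ⟨w, hw⟩ := hc.exists_hasEigenvector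
  -- the eigenspace is invariant, hence all of `V`
  let W : Submodule ℂ H := V ⊓
    LinearMap.ker ((V.starProjection * g - c • 1 : H →L[ℂ] H) : H →ₗ[ℂ] H)
  have hW (v : H) : v ∈ W ↔ v ∈ V ∧ V.starProjection (g v) = c • v := by
    simp [W, sub_eq_zero]
  have hWV : W = V := by
    refine hV.eq_of_le W inf_le_left ?_ ?_
    · intro f hf v hv
      rw [hW] at hv ⊢
      refine ⟨hV.invariant f hf v hv.1, ?_⟩
      rw [← mem_commutant_iff.1 hg f hf,
        ← mem_commutant_iff.1 hV.invariant.starProjection_mem_commutant f hf, hv.2, map_smul]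
    · intro h
      have hmem : (w : H) ∈ W := (hW _).2 ⟨w.2, congrArg Subtype.val hw.apply_eq_smul⟩
      rw [h, Submodule.mem_bot] at hmem
      exact hw.2 (Subtype.ext hmem)
  exact ⟨c, fun v hv => ((hW v).1 (hWV ▸ hv)).2⟩

theorem inner_starProjection_left_of_mem {V : Submodule ℂ H} {v : H} (hv : v ∈ V) (w : H) :
    inner ℂ v (V.starProjection w) = inner ℂ v w := by
  have h := Submodule.sub_starProjection_mem_orthogonal (K := V) w v hv
  rw [inner_sub_right, sub_eq_zero] at h
  exact h.symm

theorem IsIrreducible.exists_inner_eq {V : Submodule ℂ H} (hV : IsIrreducible 𝒜 V)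
    {g : H →L[ℂ] H} (hg : g ∈ commutant 𝒜) :
    ∃ c : ℂ, ∀ v ∈ V, ∀ w ∈ V, inner ℂ v (g w) = c * inner ℂ v w := by
  obtain ⟨c, hc⟩ := hV.exists_scalar hg
  refine ⟨c, fun v hv w hw => ?_⟩
  rw [← inner_starProjection_left_of_mem hv, hc w hw, inner_smul_right]

/-- Two subspaces are linked if some operator in the commutant has a nonzero component between
them; for irreducible subspaces this means that they are isomorphic representations of `𝒜`. -/
def Linked (𝒜 : StarSubalgebra ℂ (H →L[ℂ] H)) (V W : Submodule ℂ H) : Prop :=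
  ∃ g ∈ commutant 𝒜, ∃ v ∈ V, ∃ w ∈ W, inner ℂ w (g v) ≠ 0

/-- Linked irreducible subspaces are unitarily equivalent: some operator in the commutant maps the
first isometrically onto the second. -/
theorem Linked.exists_isometry {V W : Submodule ℂ H} (hV : IsIrreducible 𝒜 V)
    (hW : IsIrreducible 𝒜 W) (h : Linked 𝒜 V W) :
    ∃ u ∈ commutant 𝒜, V.map (u : H →ₗ[ℂ] H) = W ∧
      ∀ v ∈ V, ∀ v' ∈ V, inner ℂ (u v) (u v') = inner ℂ v v' := by
  obtain ⟨g, hg, v₀, hv₀, w₀, hw₀, hne⟩ := h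
  let g' : H →L[ℂ] H := W.starProjection * g
  have hg' : g' ∈ commutant 𝒜 := mul_mem hW.invariant.starProjection_mem_commutant hg
  obtain ⟨c, hc⟩ := hV.exists_inner_eq (mul_mem (star_mem hg') hg')
  have hc' : ∀ v ∈ V, ∀ v' ∈ V, inner ℂ (g' v) (g' v') = c * inner ℂ v v' := fun v hv v' hv' => by
    rw [← hc v hv v' hv']
    exact (ContinuousLinearMap.adjoint_inner_right g' v (g' v')).symm
  have hg'v₀ : g' v₀ ≠ 0 := fun h0 => hne (by
    rw [← inner_starProjection_left_of_mem hw₀]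
    change inner ℂ w₀ (g' v₀) = 0
    rw [h0, inner_zero_right])
  have hv₀0 : v₀ ≠ 0 := fun h0 => hg'v₀ (by rw [h0, map_zero])
  -- the scalar is the positive number `‖g' v₀‖² / ‖v₀‖²`
  have hcval : c = ((‖g' v₀‖ / ‖v₀‖ : ℝ) : ℂ) ^ 2 := by
    have h1 := hc' v₀ hv₀ v₀ hv₀
    rw [inner_self_eq_norm_sq_to_K, inner_self_eq_norm_sq_to_K] at h1
    have h2 : ((‖v₀‖ : ℝ) : ℂ) ≠ 0 := by exact_mod_cast norm_ne_zero_iff.2 hv₀0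
    push_cast
    rw [div_pow, eq_div_iff (pow_ne_zero 2 h2)]
    exact h1.symm
  have hpos : (0 : ℝ) < ‖g' v₀‖ / ‖v₀‖ := div_pos (norm_pos_iff.2 hg'v₀) (norm_pos_iff.2 hv₀0)
  generalize ‖g' v₀‖ / ‖v₀‖ = s at hcval hpos
  have hs : ((s : ℝ) : ℂ) ≠ 0 := by exact_mod_cast hpos.ne'
  have hu : ((s : ℂ)⁻¹ • g') ∈ commutant 𝒜 := (commutant 𝒜).toSubalgebra.smul_mem hg' _
  refine ⟨(s : ℂ)⁻¹ • g', hu, ?_, fun v hv v' hv' => ?_⟩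
  · refine hW.eq_of_le _ ?_ (hV.invariant.map hu) ?_
    · rintro _ ⟨v, -, rfl⟩
      exact W.smul_mem _ (W.starProjection_apply_mem _)
    · intro h0
      have : ((s : ℂ)⁻¹ • g') v₀ ∈ (⊥ : Submodule ℂ H) := h0 ▸ ⟨v₀, hv₀, rfl⟩
      rw [Submodule.mem_bot, _root_.smul_apply] at this
      exact smul_ne_zero (inv_ne_zero hs) hg'v₀ this
  · rw [_root_.smul_apply, _root_.smul_apply, inner_smul_left,
      inner_smul_right, hc' v hv v' hv', hcval, map_inv₀, Complex.conj_ofReal]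
    field_simp

theorem Linked.refl {V : Submodule ℂ H} (hV : V ≠ ⊥) : Linked 𝒜 V V := by
  obtain ⟨v, hv, hv0⟩ := Submodule.exists_mem_ne_zero_of_ne_bot hV
  exact ⟨1, one_mem _, v, hv, v, hv, inner_self_ne_zero.2 hv0⟩

theorem Linked.symm {V W : Submodule ℂ H} (h : Linked 𝒜 V W) : Linked 𝒜 W V := by
  obtain ⟨g, hg, v, hv, w, hw, hne⟩ := h
  refine ⟨star g, star_mem hg, w, hw, v, hv, fun h0 => hne ?_⟩
  rw [ContinuousLinearMap.star_eq_adjoint, ContinuousLinearMap.adjoint_inner_right] at h0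
  rw [← inner_conj_symm, h0, map_zero]

theorem Linked.trans {V W X : Submodule ℂ H} (hV : IsIrreducible 𝒜 V) (hW : IsIrreducible 𝒜 W)
    (h : Linked 𝒜 V W) (h' : Linked 𝒜 W X) : Linked 𝒜 V X := by
  obtain ⟨u, hu, hmap, -⟩ := h.exists_isometry hV hW
  obtain ⟨g, hg, w, hw, x, hx, hne⟩ := h'
  rw [← hmap] at hw
  obtain ⟨v, hv, rfl⟩ := hw
  exact ⟨g * u, mul_mem hg hu, v, hv, x, hx, hne⟩

/-- The double commutant theorem in finite dimension. -/
theorem mem_of_forall_commute {f : H →L[ℂ] H}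
    (hf : ∀ g ∈ commutant 𝒜, ∀ v, f (g v) = g (f v)) : f ∈ 𝒜 := by
  classical
  let S := 𝒜.toSubalgebra
  have : IsScalarTower ℂ S H := ⟨fun c a v => rfl⟩
  have : ComplementedLattice (Submodule S H) := by
    refine ⟨fun N => ?_⟩
    have hN : IsInvariant 𝒜 (N.restrictScalars ℂ) := fun a ha v hv =>
      N.smul_mem (⟨a, ha⟩ : S) hv
    let N' : Submodule S H :=
      { (N.restrictScalars ℂ)ᗮ with smul_mem' := fun a v hv => hN.orthogonal a.1 a.2 v hv }
    have hc := Submodule.isCompl_orthogonal (K := N.restrictScalars ℂ)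
    refine ⟨N', ?_, ?_⟩
    · rw [Submodule.disjoint_def]
      exact fun v hv hv' => Submodule.disjoint_def.1 hc.disjoint v hv hv'
    · rw [codisjoint_iff, Submodule.eq_top_iff']
      intro v
      have hv : v ∈ N.restrictScalars ℂ ⊔ (N.restrictScalars ℂ)ᗮ := by
        rw [hc.sup_eq_top]
        exact Submodule.mem_top
      obtain ⟨y, hy, z, hz, rfl⟩ := Submodule.mem_sup.1 hv
      exact Submodule.mem_sup.2 ⟨y, hy, z, hz, rfl⟩
  have : IsSemisimpleModule S H := { }
  let F : Module.End (Module.End S H) H :=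
    { toFun := f
      map_add' := map_add f
      map_smul' := fun g v => by
        let g' : H →ₗ[ℂ] H := g.restrictScalars ℂ
        refine hf (LinearMap.toContinuousLinearMap g') (mem_commutant_iff.2 fun a ha v => ?_) v
        exact (g.map_smul (⟨a, ha⟩ : S) v).symm }
  let b := Module.finBasis ℂ H
  obtain ⟨a, ha⟩ := jacobson_density F (Finset.univ.image b)
  have : f = a.1 := by
    have h : (f : H →ₗ[ℂ] H) = (a.1 : H →ₗ[ℂ] H) :=
      b.ext fun i => ha (b i) (Finset.mem_image_of_mem b (Finset.mem_univ i))
    exact ContinuousLinearMap.coe_injective h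
  rw [this]
  exact a.2

end Operators

/-! ### Existence of block decompositions -/

section BlockBasis

variable {H : Type*} [NormedAddCommGroup H] [InnerProductSpace ℂ H] [FiniteDimensional ℂ H]
  [CompleteSpace H]

/-- The classes of an equivalence relation on a finite type, enumerated together with
representatives. -/
theorem exists_fin_classes {ι : Type*} [Finite ι] (r : Setoid ι) :
    ∃ (n : ℕ) (cls : ι → Fin n) (rep : Fin n → ι),
      (∀ k k', cls k = cls k' ↔ r k k') ∧ ∀ q, cls (rep q) = q := by
  classical
  let φ := Finite.equivFin (Quotient r)
  refine ⟨_, fun k => φ (Quotient.mk r k), fun q => (φ.symm q).out, fun k k' => ?_, fun q => ?_⟩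
  · rw [φ.injective.eq_iff, Quotient.eq]
  · exact (congrArg φ (Quotient.out_eq _)).trans (φ.apply_symm_apply q)

/-- An orthonormal basis adapted to a star-algebra of operators, built from pairwise inequivalent
irreducible subspaces `W q`: the vector with label `(q, a, k)` is the image of the `a`-th basis
vector of `W q` in the `k`-th orthogonal copy of `W q`. -/
structure AdaptedBasis (𝒜 : StarSubalgebra ℂ (H →L[ℂ] H)) where
  n : ℕ
  d : Fin n → ℕ
  e : Fin n → ℕ
  d_pos : ∀ q, 0 < d q
  e_pos : ∀ q, 0 < e q
  W : Fin n → Submodule ℂ H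
  irreducible : ∀ q, IsIrreducible 𝒜 (W q)
  not_linked : ∀ q q', q ≠ q' → ¬ Linked 𝒜 (W q) (W q')
  v : ∀ q, OrthonormalBasis (Fin (d q)) ℂ (W q)
  u : ∀ q, Fin (e q) → H →L[ℂ] H
  u_mem : ∀ q k, u q k ∈ commutant 𝒜
  inner_u : ∀ q k, ∀ w ∈ W q, ∀ w' ∈ W q, inner ℂ (u q k w) (u q k w') = inner ℂ w w'
  inner_u_ne : ∀ q k k', k ≠ k' → ∀ w ∈ W q, ∀ w' ∈ W q, inner ℂ (u q k w) (u q k' w') = 0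
  basis : OrthonormalBasis (BlockIndex d e) ℂ H
  basis_apply : ∀ q a k, basis ⟨q, a, k⟩ = u q k (v q a)

theorem nonempty_adaptedBasis (𝒜 : StarSubalgebra ℂ (H →L[ℂ] H)) :
    Nonempty (AdaptedBasis 𝒜) := by
  classical
  obtain ⟨m, V, hirr, horth, hsup⟩ :=
    IsInvariant.exists_orthogonal_decomposition (𝒜 := 𝒜) (W := ⊤) fun _ _ _ _ => Submodule.mem_top
  obtain ⟨n, cls, rep, hcls, hrep⟩ := exists_fin_classes
    (⟨fun k k' => Linked 𝒜 (V k) (V k'), ⟨fun k => Linked.refl (hirr k).ne_bot, fun h => h.symm,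
      fun h h' => h.trans (hirr _) (hirr _) h'⟩⟩ : Setoid (Fin m))
  have hU : ∀ q (k : {k // cls k = q}), ∃ u ∈ commutant 𝒜,
      (V (rep q)).map (u : H →ₗ[ℂ] H) = V k ∧
      ∀ v ∈ V (rep q), ∀ v' ∈ V (rep q), inner ℂ (u v) (u v') = inner ℂ v v' := by
    rintro q ⟨k, rfl⟩
    exact Linked.exists_isometry (hirr _) (hirr _) ((hcls _ _).1 (hrep (cls k)))
  choose U hUc hUmap hUiso using hU
  have hUmem : ∀ q k, ∀ w ∈ V (rep q), U q k w ∈ V k.1 := fun q k w hw =>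
    hUmap q k ▸ Submodule.mem_map_of_mem hw
  let ε : ∀ q, Fin (Fintype.card {k // cls k = q}) ≃ {k // cls k = q} :=
    fun q => (Fintype.equivFin _).symm
  let v : ∀ q, OrthonormalBasis (Fin (Module.finrank ℂ (V (rep q)))) ℂ (V (rep q)) :=
    fun q => stdOrthonormalBasis ℂ _
  -- distinct copies are orthogonal, whether or not they have the same label `q`
  have hne : ∀ q q' (k : {k // cls k = q}) (k' : {k // cls k = q'}), k.1 ≠ k'.1 →
      ∀ w ∈ V (rep q), ∀ w' ∈ V (rep q'), inner ℂ (U q k w) (U q' k' w') = 0 :=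
    fun q q' k k' hk w hw w' hw' => Submodule.isOrtho_iff_inner_eq.1 (horth _ _ hk) _
      (hUmem q k w hw) _ (hUmem q' k' w' hw')
  let b : BlockIndex (fun q => Module.finrank ℂ (V (rep q)))
      (fun q => Fintype.card {k // cls k = q}) → H := fun p => U p.1 (ε p.1 p.2.2) (v p.1 p.2.1)
  have hb : Orthonormal ℂ b := by
    rw [orthonormal_iff_ite]
    rintro ⟨q, a, k⟩ ⟨q', a', k'⟩
    by_cases hq : q = q'
    · subst hq
      by_cases hk : k = k'
      · subst hk
        change inner ℂ (U q (ε q k) (v q a)) (U q (ε q k) (v q a')) = _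
        rw [hUiso q _ _ (v q a).2 _ (v q a').2, ← Submodule.coe_inner,
          orthonormal_iff_ite.1 (v q).orthonormal]
        simp
      · rw [if_neg (by simpa using fun _ => hk)]
        exact hne q q _ _ (fun h => hk ((ε q).injective (Subtype.ext h))) _ (v q a).2 _ (v q a').2
    · rw [if_neg (fun h => hq (congrArg Sigma.fst h))]
      refine hne q q' _ _ (fun h => hq ?_) _ (v q a).2 _ (v q' a').2
      rw [← (ε q k).2, ← (ε q' k').2, h]
  have hspan : ⊤ ≤ Submodule.span ℂ (Set.range b) := by
    rw [← hsup]
    refine iSup_le fun k => ?_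
    rw [← hUmap (cls k) ⟨k, rfl⟩, Submodule.map_le_iff_le_comap]
    intro w hw
    rw [Submodule.mem_comap]
    have h : ((∑ a, (v (cls k)).repr ⟨w, hw⟩ a • v (cls k) a : V (rep (cls k))) : H) = w :=
      congrArg Subtype.val ((v (cls k)).sum_repr ⟨w, hw⟩)
    rw [← h, Submodule.coe_sum, map_sum]
    refine Submodule.sum_mem _ fun a _ => ?_
    rw [Submodule.coe_smul, map_smul]
    refine Submodule.smul_mem _ _ (Submodule.subset_span ⟨⟨cls k, a, (ε _).symm ⟨k, rfl⟩⟩, ?_⟩)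
    simp [b]
  exact ⟨{
    n := n
    d := _
    e := _
    d_pos := fun q => by
      have : Nontrivial (V (rep q)) := Submodule.nontrivial_iff_ne_bot.2 (hirr _).ne_bot
      exact Module.finrank_pos
    e_pos := fun q => Fintype.card_pos_iff.2 ⟨⟨rep q, hrep q⟩⟩
    W := fun q => V (rep q)
    irreducible := fun q => hirr _
    not_linked := fun q q' hq h => hq (by
      have := (hcls _ _).2 h
      rwa [hrep, hrep] at this)
    v := v
    u := fun q k => U q (ε q k)
    u_mem := fun q k => hUc _ _
    inner_u := fun q k => hUiso q _
    inner_u_ne := fun q k k' hk => hne q q _ _ fun h => hk ((ε q).injective (Subtype.ext h))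
    basis := OrthonormalBasis.mk hb hspan
    basis_apply := fun q a k => by rw [OrthonormalBasis.coe_mk] }⟩

namespace AdaptedBasis

variable {𝒜 : StarSubalgebra ℂ (H →L[ℂ] H)} (b : AdaptedBasis 𝒜)

/-- The matrix of an operator with respect to an adapted basis. -/
noncomputable def toMatrix (f : H →L[ℂ] H) : Matrix (BlockIndex b.d b.e) (BlockIndex b.d b.e) ℂ :=
  LinearMap.toMatrixOrthonormal b.basis (f : H →ₗ[ℂ] H)

theorem toMatrix_apply (f : H →L[ℂ] H) (p p' : BlockIndex b.d b.e) :
    b.toMatrix f p p' = inner ℂ (b.basis p) (f (b.basis p')) :=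
  LinearMap.toMatrixOrthonormal_apply_apply _ _ _ _

theorem toMatrix_mul (f g : H →L[ℂ] H) : b.toMatrix (f * g) = b.toMatrix f * b.toMatrix g :=
  map_mul (LinearMap.toMatrixOrthonormal b.basis) (f : H →ₗ[ℂ] H) g

theorem toMatrix_injective : Function.Injective b.toMatrix := fun _ _ h =>
  ContinuousLinearMap.coe_injective ((LinearMap.toMatrixOrthonormal b.basis).injective h)

/-- Inequivalent irreducible subspaces are not connected by the commutant. -/
theorem inner_apply_eq_zero {g : H →L[ℂ] H} (hg : g ∈ commutant 𝒜) {q q' : Fin b.n}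
    (hq : q ≠ q') (k : Fin (b.e q)) (k' : Fin (b.e q')) {w w' : H} (hw : w ∈ b.W q)
    (hw' : w' ∈ b.W q') : inner ℂ (b.u q k w) (g (b.u q' k' w')) = 0 := by
  by_contra h
  refine b.not_linked q' q hq.symm ⟨star (b.u q k) * (g * b.u q' k'),
    mul_mem (star_mem (b.u_mem q k)) (mul_mem hg (b.u_mem q' k')), w', hw', w, hw, ?_⟩
  rw [← ContinuousLinearMap.adjoint_inner_right] at h
  exact h

theorem inner_u_of_ne {q q' : Fin b.n} (hq : q ≠ q') (k : Fin (b.e q)) (k' : Fin (b.e q'))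
    {w w' : H} (hw : w ∈ b.W q) (hw' : w' ∈ b.W q') :
    inner ℂ (b.u q k w) (b.u q' k' w') = 0 :=
  b.inner_apply_eq_zero (one_mem _) hq k k' hw hw'

/-- The commutant acts on the multiplicity spaces only. -/
theorem toMatrix_of_mem_commutant {g : H →L[ℂ] H} (hg : g ∈ commutant 𝒜) :
    ∃ c : (q : Fin b.n) → Matrix (Fin (b.e q)) (Fin (b.e q)) ℂ,
      b.toMatrix g = Matrix.blockDiagonal' fun q =>
        (1 : Matrix (Fin (b.d q)) (Fin (b.d q)) ℂ) ⊗ₖ c q := by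
  have h : ∀ q k k', ∃ c : ℂ, ∀ w ∈ b.W q, ∀ w' ∈ b.W q,
      inner ℂ (b.u q k w) (g (b.u q k' w')) = c * inner ℂ w w' := fun q k k' => by
    obtain ⟨c, hc⟩ := (b.irreducible q).exists_inner_eq
      (mul_mem (star_mem (b.u_mem q k)) (mul_mem hg (b.u_mem q k')))
    refine ⟨c, fun w hw w' hw' => ?_⟩
    rw [← hc w hw w' hw', ← ContinuousLinearMap.adjoint_inner_right]
    rfl
  choose c hc using h
  refine ⟨fun q => Matrix.of (c q), ?_⟩
  ext ⟨q, a, k⟩ ⟨q', a', k'⟩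
  rw [toMatrix_apply, b.basis_apply, b.basis_apply]
  by_cases hq : q = q'
  · subst hq
    rw [hc _ _ _ _ (b.v q a).2 _ (b.v q a').2, ← Submodule.coe_inner,
      orthonormal_iff_ite.1 (b.v q).orthonormal, Matrix.blockDiagonal'_apply_eq,
      Matrix.kronecker_apply, Matrix.one_apply, mul_comm]
    rfl
  · rw [Matrix.blockDiagonal'_apply_ne _ _ _ hq,
      b.inner_apply_eq_zero hg hq _ _ (b.v q a).2 (b.v q' a').2]

/-- The algebra acts in the same way on all copies of an irreducible subspace. -/
theorem toMatrix_of_mem {f : H →L[ℂ] H} (hf : f ∈ 𝒜) :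
    ∃ x : (q : Fin b.n) → Matrix (Fin (b.d q)) (Fin (b.d q)) ℂ,
      b.toMatrix f = Matrix.blockDiagonal' fun q =>
        x q ⊗ₖ (1 : Matrix (Fin (b.e q)) (Fin (b.e q)) ℂ) := by
  refine ⟨fun q => Matrix.of fun a a' => inner ℂ (b.v q a : H) (f (b.v q a')), ?_⟩
  have hW : ∀ q a, f (b.v q a) ∈ b.W q := fun q a =>
    (b.irreducible q).invariant f hf _ (b.v q a).2
  ext ⟨q, a, k⟩ ⟨q', a', k'⟩
  rw [toMatrix_apply, b.basis_apply, b.basis_apply, mem_commutant_iff.1 (b.u_mem q' k') f hf]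
  by_cases hq : q = q'
  · subst hq
    rw [Matrix.blockDiagonal'_apply_eq, Matrix.kronecker_apply, Matrix.one_apply]
    by_cases hk : k = k'
    · subst hk
      rw [b.inner_u _ _ _ (b.v q a).2 _ (hW q a'), if_pos rfl, mul_one]
      rfl
    · rw [b.inner_u_ne _ _ _ hk _ (b.v q a).2 _ (hW q a'), if_neg hk, mul_zero]
  · rw [Matrix.blockDiagonal'_apply_ne _ _ _ hq,
      b.inner_u_of_ne hq _ _ (b.v q a).2 (hW q' a')]

theorem mem_iff {f : H →L[ℂ] H} :
    f ∈ 𝒜 ↔ ∃ x : (q : Fin b.n) → Matrix (Fin (b.d q)) (Fin (b.d q)) ℂ,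
      b.toMatrix f = Matrix.blockDiagonal' fun q =>
        x q ⊗ₖ (1 : Matrix (Fin (b.e q)) (Fin (b.e q)) ℂ) := by
  refine ⟨b.toMatrix_of_mem, ?_⟩
  rintro ⟨x, hx⟩
  refine mem_of_forall_commute fun g hg v => ?_
  obtain ⟨c, hc⟩ := b.toMatrix_of_mem_commutant hg
  have h : f * g = g * f := b.toMatrix_injective (by
    rw [toMatrix_mul, toMatrix_mul, hx, hc, ← Matrix.blockDiagonal'_mul,
      ← Matrix.blockDiagonal'_mul]
    simp only [← Matrix.mul_kronecker_mul, Matrix.one_mul, Matrix.mul_one])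
  exact DFunLike.congr_fun h v

end AdaptedBasis

/-- Every unital star-algebra of matrices has a block decomposition. -/
theorem nonempty_blockDecomposition {C : Type*} [Fintype C] [DecidableEq C]
    (A : StarSubalgebra ℂ (Matrix C C ℂ)) : Nonempty (BlockDecomposition A) := by
  let Φ := Matrix.toEuclideanCLM (𝕜 := ℂ) (n := C)
  obtain ⟨b⟩ := nonempty_adaptedBasis (A.map Φ.toStarAlgHom)
  let Z : Matrix (BlockIndex b.d b.e) C ℂ := Matrix.of fun p c => star (b.basis p c)
  have hZ : ∀ a, Z * a * Zᴴ = b.toMatrix (Φ a) := by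
    intro a
    ext p p'
    rw [b.toMatrix_apply, Matrix.mul_assoc, Matrix.mul_apply]
    simp only [PiLp.inner_apply]
    refine Finset.sum_congr rfl fun c _ => ?_
    rw [RCLike.inner_apply, mul_comm]
    congr 1
    simp [Φ, Z, Matrix.mul_apply, Matrix.mulVec, dotProduct]
  have h1 : Z * Zᴴ = 1 := by
    have := hZ 1
    rw [Matrix.mul_one, map_one] at this
    rw [this]
    exact map_one (LinearMap.toMatrixOrthonormal b.basis)
  have hcard : Fintype.card (BlockIndex b.d b.e) = Fintype.card C := by
    rw [← Module.finrank_eq_card_basis b.basis.toBasis, finrank_euclideanSpace]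
  exact ⟨{
    n := b.n
    d := b.d
    e := b.e
    d_pos := b.d_pos
    e_pos := b.e_pos
    Z := Z
    Z_mul_star := h1
    star_mul_Z := (Matrix.mul_eq_one_comm_of_equiv (Fintype.equivOfCardEq hcard)).1 h1
    mem_iff := fun a => by
      rw [hZ, ← b.mem_iff, StarSubalgebra.mem_map]
      constructor
      · exact fun ha => ⟨a, ha, rfl⟩
      · rintro ⟨a', ha', h⟩
        rwa [← Φ.injective h] }⟩

end BlockBasis

/-! ### Unitaries that normalize a sum of full matrix algebras -/

section Normalizer

theorem exists_mulVec_eq {k : Type*} [Fintype k] [DecidableEq k] {v : k → ℂ} (hv : v ≠ 0)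
    (w : k → ℂ) : ∃ x : Matrix k k ℂ, x.mulVec v = w := by
  obtain ⟨a, ha⟩ := Function.ne_iff.1 hv
  refine ⟨Matrix.vecMulVec w (Pi.single a (v a)⁻¹), ?_⟩
  rw [Matrix.vecMulVec_mulVec, single_dotProduct, inv_mul_cancel₀ ha]
  simp

/-- A nonzero matrix that intertwines all endomorphisms on one side with all endomorphisms on the
other side is invertible, since its kernel and its range are invariant. -/
theorem exists_inverse_of_intertwines {p q : Type*} [Fintype p] [DecidableEq p] [Fintype q]
    [DecidableEq q] {M : Matrix p q ℂ} (hM : M ≠ 0)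
    (h1 : ∀ x : Matrix q q ℂ, ∃ y : Matrix p p ℂ, M * x = y * M)
    (h2 : ∀ y : Matrix p p ℂ, ∃ x : Matrix q q ℂ, M * x = y * M) :
    Fintype.card p = Fintype.card q ∧ ∃ N : Matrix q p ℂ, M * N = 1 ∧ N * M = 1 := by
  obtain ⟨v₀, hv₀⟩ : ∃ v₀, M.mulVec v₀ ≠ 0 := by
    by_contra! h
    exact hM (Matrix.ext_of_mulVec_single fun i => by rw [h, Matrix.zero_mulVec])
  have hinj : Function.Injective (Matrix.toLin' M) := by
    rw [injective_iff_map_eq_zero]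
    intro v hv
    by_contra hne
    obtain ⟨x, hx⟩ := exists_mulVec_eq hne v₀
    obtain ⟨y, hy⟩ := h1 x
    rw [Matrix.toLin'_apply] at hv
    apply hv₀
    rw [← hx, Matrix.mulVec_mulVec, hy, ← Matrix.mulVec_mulVec, hv, Matrix.mulVec_zero]
  have hsurj : Function.Surjective (Matrix.toLin' M) := by
    intro w
    obtain ⟨y, hy⟩ := exists_mulVec_eq hv₀ w
    obtain ⟨x, hx⟩ := h2 y
    refine ⟨x.mulVec v₀, ?_⟩
    rw [Matrix.toLin'_apply, Matrix.mulVec_mulVec, hx, ← Matrix.mulVec_mulVec, hy]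
  let E := LinearEquiv.ofBijective (Matrix.toLin' M) ⟨hinj, hsurj⟩
  have hM' : LinearMap.toMatrix' (E : (q → ℂ) →ₗ[ℂ] (p → ℂ)) = M := LinearMap.toMatrix'_toLin' M
  refine ⟨?_, LinearMap.toMatrix' (E.symm : (p → ℂ) →ₗ[ℂ] (q → ℂ)), ?_, ?_⟩
  · simpa using E.finrank_eq.symm
  · conv_lhs => rw [← hM']
    rw [← LinearMap.toMatrix'_comp]
    simp
  · conv_lhs => rw [← hM']
    rw [← LinearMap.toMatrix'_comp]
    simp

theorem eq_smul_one_of_kronecker_eq_one {p q : Type*} [Fintype p] [DecidableEq p] [Nonempty p]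
    [Fintype q] [DecidableEq q] [Nonempty q] {p' : Type*} [Fintype p'] {T : Matrix p' p ℂ}
    {B : Matrix q q ℂ} (h : (Tᴴ * T) ⊗ₖ B = 1) :
    ∃ s : ℝ, 0 < s ∧ Tᴴ * T = (s : ℂ) • 1 ∧ B = (s : ℂ)⁻¹ • 1 := by
  obtain ⟨x₀⟩ := ‹Nonempty p›
  obtain ⟨y₀⟩ := ‹Nonempty q›
  have key (x x' : p) (y y' : q) : (Tᴴ * T) x x' * B y y' =
      (1 : Matrix p p ℂ) x x' * (1 : Matrix q q ℂ) y y' := by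
    rw [← Matrix.kronecker_apply, h, ← Matrix.one_kronecker_one, Matrix.kronecker_apply]
  have hs : (Tᴴ * T) x₀ x₀ = ((∑ k, ‖T k x₀‖ ^ 2 : ℝ) : ℂ) := by
    rw [Matrix.mul_apply]
    push_cast
    refine Finset.sum_congr rfl fun k _ => ?_
    rw [Matrix.conjTranspose_apply]
    exact Complex.conj_mul' _
  have h0 : 0 ≤ ∑ k, ‖T k x₀‖ ^ 2 := Finset.sum_nonneg fun k _ => sq_nonneg _
  generalize (∑ k, ‖T k x₀‖ ^ 2) = s at hs h0
  have h1 : (s : ℂ) * B y₀ y₀ = 1 := by simpa [hs] using key x₀ x₀ y₀ y₀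
  have hs0 : (s : ℂ) ≠ 0 := left_ne_zero_of_mul_eq_one h1
  refine ⟨s, lt_of_le_of_ne h0 fun h => hs0 (by rw [← h, Complex.ofReal_zero]), ?_, ?_⟩
  · ext x x'
    have h2 := key x x' y₀ y₀
    rw [Matrix.one_apply_eq, mul_one] at h2
    rw [Matrix.smul_apply, smul_eq_mul, ← h2, mul_left_comm, h1, mul_one]
  · ext y y'
    have h2 := key x₀ x₀ y y'
    rw [Matrix.one_apply_eq, one_mul, hs] at h2
    rw [Matrix.smul_apply, smul_eq_mul, ← h2, inv_mul_cancel_left₀ hs0]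

/-- If `A ⊗ B` has orthonormal columns, then a rescaling makes both factors have orthonormal
columns. -/
theorem exists_rescale_isometry {p q p' q' : Type*} [Fintype p] [DecidableEq p] [Nonempty p]
    [Fintype q] [DecidableEq q] [Nonempty q] [Fintype p'] [Fintype q']
    {A : Matrix p' p ℂ} {B : Matrix q' q ℂ} (h : (Aᴴ * A) ⊗ₖ (Bᴴ * B) = 1) :
    ∃ (T : Matrix p' p ℂ) (Q : Matrix q' q ℂ), Tᴴ * T = 1 ∧ Qᴴ * Q = 1 ∧
      ∀ x x' y y', A x x' * B y y' = T x x' * Q y y' := by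
  obtain ⟨s, hs, hA, hB⟩ := eq_smul_one_of_kronecker_eq_one h
  have hr : (0 : ℝ) < Real.sqrt s := Real.sqrt_pos.2 hs
  have hrr : (s : ℂ) = (Real.sqrt s : ℂ) * (Real.sqrt s : ℂ) := by
    rw [← Complex.ofReal_mul, Real.mul_self_sqrt hs.le]
  generalize Real.sqrt s = r at hr hrr
  have hr0 : (r : ℂ) ≠ 0 := by exact_mod_cast hr.ne'
  refine ⟨(r : ℂ)⁻¹ • A, (r : ℂ) • B, ?_, ?_, fun x x' y y' => ?_⟩
  · rw [Matrix.conjTranspose_smul, Matrix.smul_mul, Matrix.mul_smul, hA, smul_smul, smul_smul,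
      hrr, star_inv₀, RCLike.star_def, Complex.conj_ofReal]
    have : (r : ℂ)⁻¹ * (r : ℂ)⁻¹ * (r * r) = 1 := by field_simp
    rw [this, one_smul]
  · rw [Matrix.conjTranspose_smul, Matrix.smul_mul, Matrix.mul_smul, hB, smul_smul, smul_smul,
      hrr, RCLike.star_def, Complex.conj_ofReal]
    have : (r : ℂ) * r * ((r : ℂ) * r)⁻¹ = 1 := mul_inv_cancel₀ (mul_ne_zero hr0 hr0)
    rw [this, one_smul]
  · simp only [Matrix.smul_apply, smul_eq_mul]
    field_simp

theorem card_le_of_conjTranspose_mul_eq_one {p q : Type*} [Fintype p] [Fintype q] [DecidableEq q]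
    {Q : Matrix p q ℂ} (h : Qᴴ * Q = 1) : Fintype.card q ≤ Fintype.card p := by
  calc Fintype.card q = (Qᴴ * Q).rank := by rw [h, Matrix.rank_one]
    _ ≤ Q.rank := Matrix.rank_mul_le_right _ _
    _ ≤ Fintype.card p := Matrix.rank_le_card_height _

variable {n : ℕ} {X Y : Fin n → Type*} [∀ i, Fintype (X i)] [∀ i, DecidableEq (X i)]
  [∀ i, Nonempty (X i)] [∀ i, Fintype (Y i)] [∀ i, DecidableEq (Y i)] [∀ i, Nonempty (Y i)]

/-- The `X`-components of the block of `U` from block `i` to block `j`. -/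
def component (U : Matrix (Σ i, X i × Y i) (Σ i, X i × Y i) ℂ) (j i : Fin n) (b : Y j) (b' : Y i) :
    Matrix (X j) (X i) ℂ :=
  Matrix.of fun a a' => U ⟨j, a, b⟩ ⟨i, a', b'⟩

theorem component_mul {U : Matrix (Σ i, X i × Y i) (Σ i, X i × Y i) ℂ}
    {x y : (i : Fin n) → Matrix (X i) (X i) ℂ}
    (h : U * Matrix.blockDiagonal' (fun i => x i ⊗ₖ (1 : Matrix (Y i) (Y i) ℂ)) =
      Matrix.blockDiagonal' (fun i => y i ⊗ₖ (1 : Matrix (Y i) (Y i) ℂ)) * U)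
    (j i : Fin n) (b : Y j) (b' : Y i) :
    component U j i b b' * x i = y j * component U j i b b' := by
  ext a a'
  have h' := congrFun (congrFun h ⟨j, a, b⟩) ⟨i, a', b'⟩
  rw [Matrix.mul_apply, Matrix.mul_apply, Fintype.sum_sigma, Fintype.sum_sigma,
    Finset.sum_eq_single i, Finset.sum_eq_single j] at h'
  · simpa [Fintype.sum_prod_type, Matrix.blockDiagonal'_apply_eq, Matrix.one_apply,
      Matrix.mul_apply, component] using h'
  · intro k _ hk
    simp [Matrix.blockDiagonal'_apply_ne _ _ _ hk.symm]
  · simp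
  · intro k _ hk
    simp [Matrix.blockDiagonal'_apply_ne _ _ _ hk]
  · simp

/-- A unitary that normalizes `⊕ᵢ M_{X i} ⊗ 1_{Y i}` permutes the blocks and is a product operator
on each block. The components of its blocks intertwine full matrix algebras, so that they are zero
or invertible; in each row and in each column of blocks, the algebra separates all but one block;
and two nonzero components of a block are proportional because their quotient is central. -/
theorem exists_perm_tensor_of_normalizes
    {U : Matrix (Σ i, X i × Y i) (Σ i, X i × Y i) ℂ}
    (hU : U ∈ Matrix.unitaryGroup (Σ i, X i × Y i) ℂ)
    (h1 : ∀ x : (i : Fin n) → Matrix (X i) (X i) ℂ, ∃ y : (i : Fin n) → Matrix (X i) (X i) ℂ,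
      U * Matrix.blockDiagonal' (fun i => x i ⊗ₖ (1 : Matrix (Y i) (Y i) ℂ)) =
        Matrix.blockDiagonal' (fun i => y i ⊗ₖ (1 : Matrix (Y i) (Y i) ℂ)) * U)
    (h2 : ∀ y : (i : Fin n) → Matrix (X i) (X i) ℂ, ∃ x : (i : Fin n) → Matrix (X i) (X i) ℂ,
      U * Matrix.blockDiagonal' (fun i => x i ⊗ₖ (1 : Matrix (Y i) (Y i) ℂ)) =
        Matrix.blockDiagonal' (fun i => y i ⊗ₖ (1 : Matrix (Y i) (Y i) ℂ)) * U) :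
    ∃ σ : Equiv.Perm (Fin n),
      (∀ i, Fintype.card (X (σ i)) = Fintype.card (X i)) ∧
      (∀ i, Fintype.card (Y (σ i)) = Fintype.card (Y i)) ∧
      ∃ (T : (i : Fin n) → Matrix (X (σ i)) (X i) ℂ) (Q : (i : Fin n) → Matrix (Y (σ i)) (Y i) ℂ),
        (∀ i, (T i)ᴴ * T i = 1) ∧ (∀ i, (Q i)ᴴ * Q i = 1) ∧
        (∀ i a a' b b', U ⟨σ i, a, b⟩ ⟨i, a', b'⟩ = T i a a' * Q i b b') ∧
        ∀ j i, j ≠ σ i → ∀ p p', U ⟨j, p⟩ ⟨i, p'⟩ = 0 := by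
  have h1' : ∀ x : (i : Fin n) → Matrix (X i) (X i) ℂ, ∃ y : (i : Fin n) → Matrix (X i) (X i) ℂ,
      ∀ j i b b', component U j i b b' * x i = y j * component U j i b b' := fun x =>
    (h1 x).imp fun y h => component_mul h
  have h2' : ∀ y : (i : Fin n) → Matrix (X i) (X i) ℂ, ∃ x : (i : Fin n) → Matrix (X i) (X i) ℂ,
      ∀ j i b b', component U j i b b' * x i = y j * component U j i b b' := fun y =>
    (h2 y).imp fun x h => component_mul h
  have hinv : ∀ j i b b', component U j i b b' ≠ 0 →
      Fintype.card (X j) = Fintype.card (X i) ∧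
      ∃ N : Matrix (X i) (X j) ℂ, component U j i b b' * N = 1 ∧ N * component U j i b b' = 1 := by
    intro j i b b' hne
    refine exists_inverse_of_intertwines hne (fun x => ?_) (fun y => ?_)
    · obtain ⟨y, hy⟩ := h1' (Function.update (fun _ => 0) i x)
      exact ⟨y j, by simpa using hy j i b b'⟩
    · obtain ⟨x, hx⟩ := h2' (Function.update (fun _ => 0) j y)
      exact ⟨x i, by simpa using hx j i b b'⟩
  -- in a row of blocks, an element of the algebra that is `1` on one block and `0` on another
  -- separates the two
  have hrow : ∀ j i i' b b' c c', component U j i b b' ≠ 0 → component U j i' c c' ≠ 0 →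
      i = i' := by
    intro j i i' b b' c c' hne hne'
    by_contra hii
    obtain ⟨y, hy⟩ := h1' (Function.update (fun _ => 0) i 1)
    obtain ⟨-, N, hN, -⟩ := hinv _ _ _ _ hne'
    have e1 := hy j i b b'
    have e2 := hy j i' c c'
    rw [Function.update_self, Matrix.mul_one] at e1
    rw [Function.update_of_ne (Ne.symm hii), Matrix.mul_zero] at e2
    have hy0 : y j = 0 := by
      rw [← Matrix.mul_one (y j), ← hN, ← Matrix.mul_assoc, ← e2, Matrix.zero_mul]
    exact hne (by rw [e1, hy0, Matrix.zero_mul])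
  -- the same for a column of blocks
  have hcol : ∀ j j' i b b' c c', component U j i b b' ≠ 0 → component U j' i c c' ≠ 0 →
      j = j' := by
    intro j j' i b b' c c' hne hne'
    by_contra hjj
    obtain ⟨x, hx⟩ := h2' (Function.update (fun _ => 0) j 1)
    obtain ⟨-, N, -, hN⟩ := hinv _ _ _ _ hne'
    have e1 := hx j i b b'
    have e2 := hx j' i c c'
    rw [Function.update_self, Matrix.one_mul] at e1
    rw [Function.update_of_ne (Ne.symm hjj), Matrix.zero_mul] at e2
    have hx0 : x i = 0 := by
      rw [← Matrix.one_mul (x i), ← hN, Matrix.mul_assoc, e2, Matrix.mul_zero]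
    exact hne (by rw [← e1, hx0, Matrix.mul_zero])
  have hUU : Uᴴ * U = 1 := Matrix.mem_unitaryGroup_iff'.1 hU
  have hex : ∀ i, ∃ j b b', component U j i b b' ≠ 0 := by
    intro i
    by_contra! h
    have a : X i := Classical.arbitrary _
    have b : Y i := Classical.arbitrary _
    have h' := congrFun (congrFun hUU ⟨i, a, b⟩) ⟨i, a, b⟩
    rw [Matrix.mul_apply, Matrix.one_apply_eq, Finset.sum_eq_zero] at h'
    · exact zero_ne_one h'
    · rintro ⟨j, a', b'⟩ -
      have : U ⟨j, a', b'⟩ ⟨i, a, b⟩ = 0 := congrFun (congrFun (h j b' b) a') a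
      rw [this, mul_zero]
  choose s β β' hs using hex
  have hsinj : Function.Injective s := by
    intro i i' hii
    have hs' := hs i'
    generalize β i' = c at hs'
    revert c
    rw [← hii]
    exact fun c hc => hrow _ _ _ _ _ _ _ (hs i) hc
  let σ : Equiv.Perm (Fin n) := Equiv.ofBijective s (Finite.injective_iff_bijective.1 hsinj)
  have hzero : ∀ j i, j ≠ s i → ∀ p p', U ⟨j, p⟩ ⟨i, p'⟩ = 0 := by
    intro j i hj p p'
    by_contra hne
    refine hj (hcol j (s i) i p.2 p'.2 _ _ (fun h => hne ?_) (hs i))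
    exact congrFun (congrFun h p.1) p'.1
  -- nonzero components of a block are proportional to each other
  have hprop : ∀ i b b', ∃ c : ℂ, component U (s i) i b b' =
      c • component U (s i) i (β i) (β' i) := by
    intro i b b'
    obtain ⟨-, N, hN, hN'⟩ := hinv _ _ _ _ (hs i)
    have hcomm : ∀ y : Matrix (X (s i)) (X (s i)) ℂ,
        Commute y (component U (s i) i b b' * N) := by
      intro y
      obtain ⟨x, hx⟩ := h2' (Function.update (fun _ => 0) (s i) y)
      have e1 := hx (s i) i b b'
      have e2 := hx (s i) i (β i) (β' i)
      rw [Function.update_self] at e1 e2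
      rw [Commute, SemiconjBy, ← Matrix.mul_assoc, ← e1, Matrix.mul_assoc, Matrix.mul_assoc]
      congr 1
      rw [← Matrix.one_mul (x i), ← hN', Matrix.mul_assoc N, e2, Matrix.mul_assoc,
        Matrix.mul_assoc, hN, Matrix.mul_one]
    obtain ⟨c, hc⟩ := Matrix.mem_range_scalar_of_commute_single
      (M := component U (s i) i b b' * N) fun k l _ => hcomm (Matrix.single k l 1)
    refine ⟨c, ?_⟩
    rw [Matrix.scalar_apply, ← Matrix.smul_one_eq_diagonal] at hc
    rw [← Matrix.mul_one (component U (s i) i b b'), ← hN', ← Matrix.mul_assoc, ← hc,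
      Matrix.smul_mul, Matrix.one_mul]
  choose q hq using hprop
  have hfac : ∀ i a a' b b', U ⟨s i, a, b⟩ ⟨i, a', b'⟩ =
      component U (s i) i (β i) (β' i) a a' * q i b b' := fun i a a' b b' => by
    rw [mul_comm]
    exact congrFun (congrFun (hq i b b') a) a'
  have hiso : ∀ i, ((component U (s i) i (β i) (β' i))ᴴ * component U (s i) i (β i) (β' i)) ⊗ₖ
      ((Matrix.of (q i))ᴴ * Matrix.of (q i)) = 1 := by
    intro i
    ext ⟨a, b⟩ ⟨a', b'⟩
    have h' := congrFun (congrFun hUU ⟨i, a, b⟩) ⟨i, a', b'⟩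
    rw [Matrix.mul_apply, Fintype.sum_sigma, Finset.sum_eq_single (s i)] at h'
    · rw [Matrix.kronecker_apply, Matrix.mul_apply, Matrix.mul_apply, Fintype.sum_mul_sum,
        ← Fintype.sum_prod_type']
      refine Eq.trans (Finset.sum_congr rfl fun p _ => ?_) (h'.trans ?_)
      · rw [Matrix.conjTranspose_apply, Matrix.conjTranspose_apply, Matrix.conjTranspose_apply,
          hfac, hfac, star_mul']
        simp only [Matrix.of_apply]
        ring
      · simp [Matrix.one_apply]
    · intro j _ hj
      refine Finset.sum_eq_zero fun p _ => ?_
      rw [hzero j i hj, mul_zero]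
    · simp
  choose T Q hT hQ hTQ using fun i => exists_rescale_isometry (hiso i)
  refine ⟨σ, fun i => (hinv _ _ _ _ (hs i)).1, ?_, T, Q, hT, hQ, fun i a a' b b' => ?_, hzero⟩
  · -- the dimensions of the second factors can only grow, and their sum is preserved
    have hle : ∀ i ∈ Finset.univ, Fintype.card (Y i) ≤ Fintype.card (Y (σ i)) := fun i _ =>
      card_le_of_conjTranspose_mul_eq_one (hQ i)
    have hsum := Equiv.sum_comp σ fun i => Fintype.card (Y i)
    exact fun i => ((Finset.sum_eq_sum_iff_of_le hle).1 hsum.symm i (Finset.mem_univ i)).symm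
  · exact (hfac i a a' b b').trans (hTQ i a a' b b')

end Normalizer

/-! ### The structure of left-walls -/

section Structure

variable {L C R : Type*} [Fintype L] [DecidableEq L] [Nonempty L] [Fintype C] [DecidableEq C]
  [Fintype R] [DecidableEq R] [Nonempty R]

/-- A unitary that normalizes `M_L ⊗ A ⊗ 1_R` has block form. -/
theorem BlockDecomposition.exists_eq_blockForm {A : StarSubalgebra ℂ (Matrix C C ℂ)}
    (B : BlockDecomposition A) {U : Matrix (L × C × R) (L × C × R) ℂ}
    (hU : U ∈ Matrix.unitaryGroup (L × C × R) ℂ)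
    (h : Ad U '' (leftProduct L R A : Set _) = (leftProduct L R A : Set _)) :
    ∃ σ : Equiv.Perm (Fin B.n), PermutesEquivalent B.d B.e σ ∧
      ∃ (T : (i : Fin B.n) → Matrix (L × Fin (B.d i)) (L × Fin (B.d i)) ℂ)
        (Q : (i : Fin B.n) → Matrix (Fin (B.e i) × R) (Fin (B.e i) × R) ℂ),
        (∀ i, T i ∈ Matrix.unitaryGroup (L × Fin (B.d i)) ℂ) ∧
        (∀ i, Q i ∈ Matrix.unitaryGroup (Fin (B.e i) × R) ℂ) ∧
        U = B.blockForm σ T Q := by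
  have : ∀ i, Nonempty (Fin (B.d i)) := fun i => ⟨⟨0, B.d_pos i⟩⟩
  have : ∀ i, Nonempty (Fin (B.e i)) := fun i => ⟨⟨0, B.e_pos i⟩⟩
  obtain ⟨U, rfl⟩ : ∃ U', U = B.pullback U' := ⟨B.push U, (B.pullback_push U).symm⟩
  rw [B.pullback_mem_unitaryGroup] at hU
  have hUU : Uᴴ * U = 1 := Matrix.mem_unitaryGroup_iff'.1 hU
  -- conjugation by `U` on `M_L ⊗ A ⊗ 1_R`, as an intertwining relation in the block basis
  have hAd : ∀ x y : (i : Fin B.n) → Matrix (L × Fin (B.d i)) (L × Fin (B.d i)) ℂ,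
      Ad (B.pullback U) (B.pullback (blockSum (R := R) x fun _ => 1)) =
        B.pullback (blockSum y fun _ => 1) →
      U * (blockSum x fun _ => 1) = (blockSum y fun _ => 1) * U := by
    intro x y hxy
    rw [Ad, B.pullback_conjTranspose, ← B.pullback_mul, ← B.pullback_mul] at hxy
    rw [← B.pullback_injective hxy, Matrix.mul_assoc _ Uᴴ, hUU, Matrix.mul_one]
  let eqv := blockEquiv L R B.d B.e
  let U' := U.submatrix eqv eqv
  have hU' : U' ∈ Matrix.unitaryGroup _ ℂ := by
    rw [Matrix.mem_unitaryGroup_iff', Matrix.star_eq_conjTranspose, Matrix.conjTranspose_submatrix,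
      Matrix.submatrix_mul_equiv, hUU, Matrix.submatrix_one_equiv]
  have hsub : ∀ x : (i : Fin B.n) → Matrix (L × Fin (B.d i)) (L × Fin (B.d i)) ℂ,
      Matrix.blockDiagonal' (fun i => x i ⊗ₖ (1 : Matrix (Fin (B.e i) × R) (Fin (B.e i) × R) ℂ)) =
        (blockSum (R := R) x fun _ => 1).submatrix eqv eqv := fun x => by
    ext p p'
    simp [blockSum, eqv]
  obtain ⟨σ, hd, he, T, Q, hT, hQ, hTQ, hzero⟩ := exists_perm_tensor_of_normalizes hU'
    (fun x => by
      have hx := Set.mem_image_of_mem (Ad (B.pullback U))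
        (SetLike.mem_coe.2 (B.mem_leftProduct_iff.2 ⟨x, rfl⟩))
      rw [h] at hx
      obtain ⟨y, hy⟩ := B.mem_leftProduct_iff.1 hx
      refine ⟨y, ?_⟩
      rw [hsub, hsub, Matrix.submatrix_mul_equiv, Matrix.submatrix_mul_equiv, hAd x y hy])
    (fun y => by
      have hy := SetLike.mem_coe.2
        ((B.mem_leftProduct_iff (R := R)).2 ⟨y, rfl⟩)
      rw [← h] at hy
      obtain ⟨_, hx, hxy⟩ := hy
      obtain ⟨x, rfl⟩ := B.mem_leftProduct_iff.1 hx
      refine ⟨x, ?_⟩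
      rw [hsub, hsub, Matrix.submatrix_mul_equiv, Matrix.submatrix_mul_equiv, hAd x y hxy])
  have hσ : PermutesEquivalent B.d B.e σ := by
    refine fun i => ⟨?_, ?_⟩
    · have := hd i
      simpa [Fintype.card_ne_zero] using this
    · have := he i
      simpa [Fintype.card_ne_zero] using this
  let cd : ∀ i, L × Fin (B.d i) ≃ L × Fin (B.d (σ i)) := fun i =>
    Equiv.prodCongr (Equiv.refl L) (finCongr (hσ i).1.symm)
  let ce : ∀ i, Fin (B.e i) × R ≃ Fin (B.e (σ i)) × R := fun i =>
    Equiv.prodCongr (finCongr (hσ i).2.symm) (Equiv.refl R)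
  refine ⟨σ, hσ, fun i => (T i).submatrix (cd i) id, fun i => (Q i).submatrix (ce i) id,
    fun i => ?_, fun i => ?_, ?_⟩
  · rw [Matrix.mem_unitaryGroup_iff', Matrix.star_eq_conjTranspose, Matrix.conjTranspose_submatrix,
      Matrix.submatrix_mul_equiv, hT, Matrix.submatrix_id_id]
  · rw [Matrix.mem_unitaryGroup_iff', Matrix.star_eq_conjTranspose, Matrix.conjTranspose_submatrix,
      Matrix.submatrix_mul_equiv, hQ, Matrix.submatrix_id_id]
  · rw [blockForm]
    congr 1
    have hP : onMid L R (blockPerm B.d B.e σ) * (onMid L R (blockPerm B.d B.e σ))ᴴ = 1 :=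
      Matrix.mem_unitaryGroup_iff.1 (onMid_mem_unitaryGroup (blockPerm_mem_unitaryGroup hσ))
    rw [← Matrix.one_mul U, ← hP, Matrix.mul_assoc, conjTranspose_blockPerm_mul hσ]
    congr 1
    ext ⟨l, ⟨i, a, b⟩, r⟩ ⟨l', ⟨j, a', b'⟩, r'⟩
    by_cases hij : i = j
    · subst hij
      rw [blockSum_apply_eq]
      exact hTQ i ((cd i) (l, a)) (l', a') ((ce i) (b, r)) (b', r')
    · rw [blockSum_apply_ne _ _ hij]
      exact hzero (σ i) j (fun h => hij (σ.injective h)) ((cd i) (l, a), (ce i) (b, r))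
        ((l', a'), (b', r'))

end Structure

end WallUnitary

theorem mainTheorem3 {L C R : Type*} [Fintype L] [DecidableEq L] [Nonempty L]
    [Fintype C] [DecidableEq C] [Nonempty C] [Fintype R] [DecidableEq R] [Nonempty R] :
    -- structure of left-walls
    (∀ U ∈ Matrix.unitaryGroup (L × C × R) ℂ, WallUnitary.IsLeftWall U →
      (∃! A : StarSubalgebra ℂ (Matrix C C ℂ), WallUnitary.HasInvariantAlgebra U A) ∧
      ∀ A : StarSubalgebra ℂ (Matrix C C ℂ), WallUnitary.HasInvariantAlgebra U A →
        Nonempty (WallUnitary.BlockDecomposition A) ∧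
        ∀ B : WallUnitary.BlockDecomposition A,
          ∃ σ : Equiv.Perm (Fin B.n), WallUnitary.PermutesEquivalent B.d B.e σ ∧
          ∃ (T : (i : Fin B.n) → Matrix (L × Fin (B.d i)) (L × Fin (B.d i)) ℂ)
            (Q : (i : Fin B.n) → Matrix (Fin (B.e i) × R) (Fin (B.e i) × R) ℂ),
            (∀ i, T i ∈ Matrix.unitaryGroup (L × Fin (B.d i)) ℂ) ∧
            (∀ i, Q i ∈ Matrix.unitaryGroup (Fin (B.e i) × R) ℂ) ∧
            U = B.blockForm σ T Q) ∧
    -- the unitaries in the blocks and the permutation are arbitrary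
    (∀ (A : StarSubalgebra ℂ (Matrix C C ℂ)) (B : WallUnitary.BlockDecomposition A)
        (σ : Equiv.Perm (Fin B.n)), WallUnitary.PermutesEquivalent B.d B.e σ →
      ∀ (T : (i : Fin B.n) → Matrix (L × Fin (B.d i)) (L × Fin (B.d i)) ℂ)
        (Q : (i : Fin B.n) → Matrix (Fin (B.e i) × R) (Fin (B.e i) × R) ℂ),
        (∀ i, T i ∈ Matrix.unitaryGroup (L × Fin (B.d i)) ℂ) →
        (∀ i, Q i ∈ Matrix.unitaryGroup (Fin (B.e i) × R) ℂ) →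
        B.blockForm σ T Q ∈ Matrix.unitaryGroup (L × C × R) ℂ ∧
        WallUnitary.IsLeftWall (B.blockForm σ T Q) ∧
        WallUnitary.Ad (B.blockForm σ T Q) '' (WallUnitary.leftProduct L R A : Set _) =
          (WallUnitary.leftProduct L R A : Set _)) ∧
    -- brickwork walls
    (∀ V ∈ Matrix.unitaryGroup (L × C) ℂ, ∀ W ∈ Matrix.unitaryGroup (C × R) ℂ,
      WallUnitary.IsLeftWall (WallUnitary.onLC V * WallUnitary.onCR W) →
      ∀ A : StarSubalgebra ℂ (Matrix C C ℂ),
        WallUnitary.HasInvariantAlgebra (WallUnitary.onLC V * WallUnitary.onCR W) A →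
      ∀ B : WallUnitary.BlockDecomposition A,
        ∃ σ : Equiv.Perm (Fin B.n), WallUnitary.PermutesEquivalent B.d B.e σ ∧
        ∃ (T : (i : Fin B.n) → Matrix (L × Fin (B.d i)) (L × Fin (B.d i)) ℂ)
          (Q : (i : Fin B.n) → Matrix (Fin (B.e i) × R) (Fin (B.e i) × R) ℂ),
          (∀ i, T i ∈ Matrix.unitaryGroup (L × Fin (B.d i)) ℂ) ∧
          (∀ i, Q i ∈ Matrix.unitaryGroup (Fin (B.e i) × R) ℂ) ∧
          WallUnitary.onLC V * WallUnitary.onCR W = B.blockForm σ T Q ∧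
          ∀ ρ π : Equiv.Perm (Fin B.n), WallUnitary.PermutesEquivalent B.d B.e ρ →
            WallUnitary.PermutesEquivalent B.d B.e π → ρ * π = σ →
          ∀ (t : (i : Fin B.n) → Matrix (Fin (B.d i)) (Fin (B.d i)) ℂ)
            (r : (i : Fin B.n) → Matrix (Fin (B.e i)) (Fin (B.e i)) ℂ),
            (∀ i, t i ∈ Matrix.unitaryGroup (Fin (B.d i)) ℂ) →
            (∀ i, r i ∈ Matrix.unitaryGroup (Fin (B.e i)) ℂ) →
            ∃ G ∈ Matrix.unitaryGroup C ℂ,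
            ∃ (T' : (i : Fin B.n) → Matrix (L × Fin (B.d i)) (L × Fin (B.d i)) ℂ)
              (Q' : (i : Fin B.n) → Matrix (Fin (B.e i) × R) (Fin (B.e i) × R) ℂ),
              (∀ i, T' i ∈ Matrix.unitaryGroup (L × Fin (B.d i)) ℂ) ∧
              (∀ i, Q' i ∈ Matrix.unitaryGroup (Fin (B.e i) × R) ℂ) ∧
              (∀ i, T i = T' i * ((1 : Matrix L L ℂ) ⊗ₖ t i)) ∧
              (∀ i, Q i = (r i ⊗ₖ (1 : Matrix R R ℂ)) * Q' i) ∧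
              WallUnitary.onLC (V * ((1 : Matrix L L ℂ) ⊗ₖ G⁻¹)) = B.leftLayer R ρ π T' r ∧
              WallUnitary.onCR ((G ⊗ₖ (1 : Matrix R R ℂ)) * W) = B.rightLayer L π t Q') ∧
    -- the unitaries in the layers and their permutations are arbitrary
    (∀ (A : StarSubalgebra ℂ (Matrix C C ℂ)) (B : WallUnitary.BlockDecomposition A)
        (ρ π : Equiv.Perm (Fin B.n)), WallUnitary.PermutesEquivalent B.d B.e ρ →
        WallUnitary.PermutesEquivalent B.d B.e π →
      ∀ (T' : (i : Fin B.n) → Matrix (L × Fin (B.d i)) (L × Fin (B.d i)) ℂ)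
        (r : (i : Fin B.n) → Matrix (Fin (B.e i)) (Fin (B.e i)) ℂ)
        (t : (i : Fin B.n) → Matrix (Fin (B.d i)) (Fin (B.d i)) ℂ)
        (Q' : (i : Fin B.n) → Matrix (Fin (B.e i) × R) (Fin (B.e i) × R) ℂ),
        (∀ i, T' i ∈ Matrix.unitaryGroup (L × Fin (B.d i)) ℂ) →
        (∀ i, r i ∈ Matrix.unitaryGroup (Fin (B.e i)) ℂ) →
        (∀ i, t i ∈ Matrix.unitaryGroup (Fin (B.d i)) ℂ) →
        (∀ i, Q' i ∈ Matrix.unitaryGroup (Fin (B.e i) × R) ℂ) →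
        ∃ V ∈ Matrix.unitaryGroup (L × C) ℂ, ∃ W ∈ Matrix.unitaryGroup (C × R) ℂ,
          WallUnitary.onLC V = B.leftLayer R ρ π T' r ∧
          WallUnitary.onCR W = B.rightLayer L π t Q' ∧
          WallUnitary.IsLeftWall (WallUnitary.onLC V * WallUnitary.onCR W) ∧
          WallUnitary.Ad (WallUnitary.onLC V * WallUnitary.onCR W) ''
              (WallUnitary.leftProduct L R A : Set _) =
            (WallUnitary.leftProduct L R A : Set _)) := by
  refine ⟨fun U hU hwall => ⟨hwall.existsUnique_hasInvariantAlgebra, fun A hA =>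
      ⟨WallUnitary.nonempty_blockDecomposition A, fun B =>
        B.exists_eq_blockForm hU (hA.Ad_image hU)⟩⟩,
    fun A B σ hσ T Q hT hQ => ⟨B.blockForm_mem_unitaryGroup hσ hT hQ,
      B.isLeftWall_blockForm hσ hT hQ, B.Ad_blockForm_image hσ hT hQ⟩, ?_, ?_⟩
  · intro V hV W hW _ A hA B
    have hU := mul_mem (WallUnitary.onLC_mem_unitaryGroup (R := R) hV)
      (WallUnitary.onCR_mem_unitaryGroup (L := L) hW)
    obtain ⟨σ, hσ, T, Q, hT, hQ, hform⟩ := B.exists_eq_blockForm hU (hA.Ad_image hU)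
    refine ⟨σ, hσ, T, Q, hT, hQ, hform, fun ρ π hρ hπ hρπ t r ht hr => ?_⟩
    -- the block unitaries of the layers are determined by `T = T' (1 ⊗ t)` and `Q = (r ⊗ 1) Q'`
    have hTt : ∀ i, T i = T i * ((1 : Matrix L L ℂ) ⊗ₖ t i)ᴴ * ((1 : Matrix L L ℂ) ⊗ₖ t i) :=
      fun i => by
        have h := Matrix.mem_unitaryGroup_iff'.1
          (WallUnitary.one_kronecker_mem_unitaryGroup (m := L) (ht i))
        rw [Matrix.star_eq_conjTranspose] at h
        rw [Matrix.mul_assoc, h, Matrix.mul_one]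
    have hrQ : ∀ i, Q i = (r i ⊗ₖ (1 : Matrix R R ℂ)) * ((r i ⊗ₖ (1 : Matrix R R ℂ))ᴴ * Q i) :=
      fun i => by
        have h := Matrix.mem_unitaryGroup_iff.1
          (WallUnitary.kronecker_one_mem_unitaryGroup (m := R) (hr i))
        rw [Matrix.star_eq_conjTranspose] at h
        rw [← Matrix.mul_assoc, h, Matrix.one_mul]
    have hT' : ∀ i, T i * ((1 : Matrix L L ℂ) ⊗ₖ t i)ᴴ ∈ Matrix.unitaryGroup _ ℂ := fun i =>
      mul_mem (hT i) (WallUnitary.conjTranspose_mem_unitaryGroup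
        (WallUnitary.one_kronecker_mem_unitaryGroup (ht i)))
    have hQ' : ∀ i, (r i ⊗ₖ (1 : Matrix R R ℂ))ᴴ * Q i ∈ Matrix.unitaryGroup _ ℂ := fun i =>
      mul_mem (WallUnitary.conjTranspose_mem_unitaryGroup
        (WallUnitary.kronecker_one_mem_unitaryGroup (hr i))) (hQ i)
    have hprod : WallUnitary.onLC V * WallUnitary.onCR W =
        B.leftLayer R ρ π (fun i => T i * ((1 : Matrix L L ℂ) ⊗ₖ t i)ᴴ) r *
          B.rightLayer L π t (fun i => (r i ⊗ₖ (1 : Matrix R R ℂ))ᴴ * Q i) := by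
      rw [B.leftLayer_mul_rightLayer hρ hπ, hρπ, hform]
      congr 1
      · exact funext hTt
      · exact funext hrQ
    obtain ⟨G, hG, hl, hr'⟩ := B.exists_gauge hV hW hρ hπ hT' hr hprod
    exact ⟨G, hG, _, _, hT', hQ', hTt, hrQ, hl, hr'⟩
  · intro A B ρ π hρ hπ T' r t Q' hT' hr ht hQ'
    obtain ⟨V, hV⟩ := B.exists_onLC_eq_leftLayer (R := R) (ρ := ρ) (π := π) T' r
    obtain ⟨W, hW⟩ := B.exists_onCR_eq_rightLayer (L := L) (π := π) t Q'
    have hT : ∀ i, T' i * ((1 : Matrix L L ℂ) ⊗ₖ t i) ∈ Matrix.unitaryGroup _ ℂ := fun i =>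
      mul_mem (hT' i) (WallUnitary.one_kronecker_mem_unitaryGroup (ht i))
    have hQ : ∀ i, (r i ⊗ₖ (1 : Matrix R R ℂ)) * Q' i ∈ Matrix.unitaryGroup _ ℂ := fun i =>
      mul_mem (WallUnitary.kronecker_one_mem_unitaryGroup (hr i)) (hQ' i)
    refine ⟨V, WallUnitary.unitary_of_onLC (R := R)
        (hV ▸ B.leftLayer_mem_unitaryGroup hρ hπ hT' hr), W,
      WallUnitary.unitary_of_onCR (L := L) (hW ▸ B.rightLayer_mem_unitaryGroup hπ ht hQ'),
      hV, hW, ?_⟩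
    rw [hV, hW, B.leftLayer_mul_rightLayer hρ hπ]
    exact ⟨B.isLeftWall_blockForm (hρ.mul hπ) hT hQ, B.Ad_blockForm_image (hρ.mul hπ) hT hQ⟩
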